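/- Let $n,m,d,s\ge 1$ be integers with $\gcd(m,n)=\gcd(d,s)=1$. A subset $\Delta\subset\mathbb{Z}_{\ge 0}$ is called $(dn,dm)$-invariant if $\Delta+dn\subset\Delta$ and $\Delta+dm\subset\Delta$; it is $0$-normalized if $0\in\Delta$, and cofinite if $\mathbb{Z}_{\ge 0}\setminus\Delta$ is finite. An $(nd)$-generator of $\Delta$ is an element $a\in\Delta$ with $a-nd\notin\Delta$. A cofinite $(dn,dm)$-invariant subset $\Delta$ is called $s$-admissible if for every remainder $j\in\{0,\dots,d-1\}$ there is an $(nd)$-generator $a\equiv j \pmod d$ of $\Delta$ such that $a+md+s\in\Delta$ (that is, $s$ is not "suspicious" for $\Delta$). An $(a,b)$-Dyck path is a lattice path from $(0,a)$ to $(b,0)$ consisting of $a$ vertical unit steps (down) and $b$ horizontal unit steps (to the right) that stays weakly below the diagonal from $(0,a)$ to $(b,0)$. Its vertical runs are its maximal blocks of consecutive vertical steps. A cabled Dyck path with parameters $(n,m),(d,s)$ consists of a $(d,s)$-Dyck path $P$ (the pattern), whose vertical runs have lengths $v_1(P),\dots,v_k(P)$ in order, together with a tuple $(D_1,\dots,D_k)$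 in which $D_i$ is an arbitrary $(v_i(P)n,v_i(P)m)$-Dyck path. **Theorem.** There is a bijection between the set of $s$-admissible $0$-normalized cofinite $(dn,dm)$-invariant subsets of $\mathbb{Z}_{\ge 0}$ and the set of cabled Dyck paths with parameters $(n,m),(d,s)$. -/

import Mathlib

/-- Unit steps of a lattice path: `V` is one unit down, `H` is one unit to the right. -/
inductive LatticeStep
  | V
  | H
  deriving DecidableEq

/-- An `(a, b)`-Dyck path: a lattice path from `(0, a)` to `(b, 0)` made of `a` vertical (down) and
`b` horizontal (right) unit steps which stays weakly below the diagonal joining `(0, a)` to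
`(b, 0)`. After `y` steps down and `x` steps to the right the path is at `(x, a - y)`, which is
weakly below that diagonal exactly when `x * a ≤ y * b`. -/
@[ext] structure RatDyckPath (a b : ℕ) where
  steps : List LatticeStep
  count_V : steps.count LatticeStep.V = a
  count_H : steps.count LatticeStep.H = b
  below : ∀ p : List LatticeStep, p <+: steps →
    p.count LatticeStep.H * a ≤ p.count LatticeStep.V * b

/-- The lengths, in order, of the vertical runs (maximal non-empty blocks of consecutive vertical
steps) of a path: cut the word at its horizontal steps and keep the non-empty blocks. -/
def RatDyckPath.verticalRuns {a b : ℕ} (P : RatDyckPath a b) : List ℕ :=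
  ((P.steps.splitOn LatticeStep.H).map List.length).filter (fun v => 0 < v)

/-- A cabled Dyck path with parameters `(n, m), (d, s)`: a `(d, s)`-Dyck path `P` (the pattern) with
vertical runs `v_1, ..., v_k`, and a `(v_i n, v_i m)`-Dyck path for each `i`. -/
structure CabledDyckPath (n m d s : ℕ) where
  pattern : RatDyckPath d s
  cable : ∀ i : Fin pattern.verticalRuns.length,
    RatDyckPath (pattern.verticalRuns.get i * n) (pattern.verticalRuns.get i * m)

/-- `Δ` is a `0`-normalized cofinite `(dn, dm)`-invariant subset of `ℤ_{≥ 0}`. -/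
structure IsInvariantSubset (n m d : ℕ) (Δ : Set ℤ) : Prop where
  nonneg : ∀ x ∈ Δ, 0 ≤ x
  zero_mem : (0 : ℤ) ∈ Δ
  cofinite : {x : ℤ | 0 ≤ x ∧ x ∉ Δ}.Finite
  add_dn_mem : ∀ x ∈ Δ, x + (d * n : ℤ) ∈ Δ
  add_dm_mem : ∀ x ∈ Δ, x + (d * m : ℤ) ∈ Δ

/-- `a` is an `N`-generator of `Δ`: `a ∈ Δ` but `a - N ∉ Δ`. -/
def IsGeneratorOf (N : ℕ) (Δ : Set ℤ) (a : ℤ) : Prop :=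
  a ∈ Δ ∧ a - (N : ℤ) ∉ Δ

/-- `x` is `j`-suspicious for `Δ`: `a + md + x ∉ Δ` for all `(nd)`-generators `a` of `Δ` with
remainder `j` modulo `d`. -/
def IsSuspiciousAt (n m d : ℕ) (Δ : Set ℤ) (x j : ℤ) : Prop :=
  ∀ a : ℤ, IsGeneratorOf (n * d) Δ a → a ≡ j [ZMOD d] → a + (m * d : ℤ) + x ∉ Δ

/-- `x` is suspicious for `Δ` if it is `j`-suspicious for at least one remainder `j`. -/
def IsSuspicious (n m d : ℕ) (Δ : Set ℤ) (x : ℤ) : Prop :=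
  ∃ j : ℤ, 0 ≤ j ∧ j < d ∧ IsSuspiciousAt n m d Δ x j

/-- `Δ` is `s`-admissible if `s` is not suspicious for `Δ`. -/
def IsSAdmissible (n m d s : ℕ) (Δ : Set ℤ) : Prop :=
  ¬ IsSuspicious n m d Δ (s : ℤ)

/-!
Write `N = n + m`. Because `s` is prime to `d`, a set `Δ` is the same as its `d` slices `A i = {x |
d * x + i * s ∈ Δ}`, `0 ≤ i < d`, and `Δ` is `(dn, dm)`-invariant exactly when every slice is `(n,
m)`-invariant. The rim `A \ (A + N)` of an invariant set has one element in each class modulo `N`,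
and it is the vertex set of a closed walk of length `N` with steps `+m` and `-n`. In these terms
`s` is non-suspicious at the residue of `i * s` exactly when `A (i + 1)` is not contained in `A i +
N`, that is, when `A i` is not `Below` the next slice (`isSuspiciousAt_iff`). Two invariant sets
with disjoint rims are always comparable for `Below` (`below_or_below_of_disjoint`). Admissible
sets thus become sequences of invariant sets without ascents (`admissible_iff_slices`); the cyclic
condition from the last slice back to the first holds automatically.

The heart of the matter is a bijection between ascent-free words of `k` invariant sets of natural
numbers, the first of which contains `0`, and `(kn, km)`-Dyck paths. Record a path by the heights
`m * #V - n * #H` of its prefixes: it is a Dyck path when it is closed and these are nonnegative.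
Reading the word from left to right, the rim of each letter is spliced as a loop into the walk
built so far, at the first vertex at which the walk meets that rim. This is loop erasure read
backwards, in the spirit of Viennot's heaps of cycles: disjoint loops commute, and the ascent-free
words are the normal forms of the resulting trace monoid. Concretely, two different removable loops
of a walk are disjoint and can be removed in either order (`Splice.diamond`), so the last letter of
a word is the lowest removable loop of the walk that it builds (`Builds.head_lowest`), which gives
injectivity (`Builds.injective`). Conversely a closed walk has a removable loop
(`exists_splice_of_closed`), and repeatedly removing a lowest one produces an ascent-free word
(`exists_builds_of_nonneg`).

For general `(d, s)`, cut the sequence of slices wherever its running minimum drops, and translate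
each block so that its minimum is `0` (`assemble` is the reverse operation). Every block is a word
as above, hence a Dyck path, and there are no ascents across cuts. Drawing a vertical step for each
slice and a horizontal step for each unit of descent of the running minimum gives the pattern; the
condition `Δ ⊆ ℕ` says that the pattern is a `(d, s)`-Dyck path (`below_diagonal_iff`), and the
non-empty blocks are its vertical runs.
-/

namespace CabledDyck

variable {n m d s : ℕ} {A B C Δ : Set ℤ}

/-! ### Invariant sets of integers and their rims -/

/-- An `(n, m)`-invariant set of integers: non-empty, bounded below, and closed under adding `n`
and `m`. It need not be normalized, nor consist of nonnegative integers. -/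
structure IsInvariant (n m : ℕ) (A : Set ℤ) : Prop where
  nonempty : A.Nonempty
  bddBelow : BddBelow A
  add_left : ∀ x ∈ A, x + n ∈ A
  add_right : ∀ x ∈ A, x + m ∈ A

/-- The `(n + m)`-generators of `A`. They are the heights visited by the closed walk bounding `A`.
-/
def rim (n m : ℕ) (A : Set ℤ) : Set ℤ := {x | x ∈ A ∧ x - (n + m) ∉ A}

/-- `A` lies strictly below `B`: the set `B` is contained in `A + (n + m)`. For invariant sets this
says that the rims are disjoint and `B ⊆ A`. -/
def Below (n m : ℕ) (A B : Set ℤ) : Prop := ∀ y ∈ B, y - (n + m) ∈ A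

theorem IsInvariant.add_sum_mul (hA : IsInvariant n m A) {x : ℤ} (hx : x ∈ A) (t : ℕ) :
    x + t * (n + m) ∈ A := by
  induction t with
  | zero => simpa using hx
  | succ t ih =>
    have := hA.add_right _ (hA.add_left _ ih)
    convert this using 1
    push_cast; ring

theorem IsInvariant.add_right_mul (hA : IsInvariant n m A) {x : ℤ} (hx : x ∈ A) (t : ℕ) :
    x + t * m ∈ A := by
  induction t with
  | zero => simpa using hx
  | succ t ih =>
    have := hA.add_right _ ih
    convert this using 1
    push_cast; ring

theorem IsInvariant.add_left_mul (hA : IsInvariant n m A) {x : ℤ} (hx : x ∈ A) (t : ℕ) :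
    x + t * n ∈ A := by
  induction t with
  | zero => simpa using hx
  | succ t ih =>
    have := hA.add_left _ ih
    convert this using 1
    push_cast; ring

theorem exists_mul_modEq {k q : ℕ} (hk : 0 < k) (h : Nat.Coprime q k) (r : ℤ) :
    ∃ t : ℕ, t < k ∧ (k : ℤ) ∣ r - t * q := by
  have hk' : (0 : ℤ) < k := by exact_mod_cast hk
  obtain ⟨u, v, huv⟩ : IsCoprime (q : ℤ) (k : ℤ) := Nat.isCoprime_iff_coprime.2 h
  refine ⟨((r * u) % k).toNat, ?_, ?_⟩
  · have := Int.emod_lt_of_pos (r * u) hk'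
    have := Int.emod_nonneg (r * u) hk'.ne'
    omega
  · rw [Int.toNat_of_nonneg (Int.emod_nonneg _ hk'.ne'), Int.emod_def]
    refine ⟨r * v + (r * u) / k * q, ?_⟩
    linear_combination (-r) * huv

theorem rim_eq_of_dvd (hn : 0 < n) (hA : IsInvariant n m A) {x y : ℤ} (hx : x ∈ rim n m A)
    (hy : y ∈ rim n m A) (h : ((n + m : ℕ) : ℤ) ∣ x - y) : x = y := by
  wlog hxy : y ≤ x generalizing x y
  · exact (this hy hx (by rw [← neg_sub]; exact h.neg_right) (by omega)).symm
  obtain ⟨c, hc⟩ := h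
  have hN : (0 : ℤ) < ((n + m : ℕ) : ℤ) := by exact_mod_cast Nat.add_pos_left hn m
  have hc0 : 0 ≤ c := by
    by_contra hneg
    nlinarith
  rcases hc0.eq_or_lt with h0 | h0
  · subst h0; simp at hc; omega
  · exfalso
    apply hx.2
    have := hA.add_sum_mul hy.1 (c - 1).toNat
    rw [Int.toNat_of_nonneg (by omega)] at this
    convert this using 1
    push_cast at hc
    linear_combination hc

theorem exists_mem_modEq_left (hn : 0 < n) (hmn : Nat.Coprime m n) (hA : IsInvariant n m A)
    (r : ℤ) : ∃ x ∈ A, (n : ℤ) ∣ r - x := by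
  obtain ⟨a, ha⟩ := hA.nonempty
  obtain ⟨t, -, ht⟩ := exists_mul_modEq hn hmn (r - a)
  exact ⟨_, hA.add_right_mul ha t, by rwa [← sub_sub]⟩

theorem exists_mem_modEq_sum (hn : 0 < n) (hmn : Nat.Coprime m n) (hA : IsInvariant n m A)
    (r : ℤ) : ∃ x ∈ A, ((n + m : ℕ) : ℤ) ∣ r - x := by
  obtain ⟨a, ha⟩ := hA.nonempty
  obtain ⟨t, -, ht⟩ := exists_mul_modEq (k := n + m) (q := m) (by omega)
    (by simpa using hmn) (r - a)
  exact ⟨_, hA.add_right_mul ha t, by rwa [← sub_sub]⟩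

/-- Subtracting `q` as long as possible from an element of `A` leads to a `q`-generator of `A`. -/
theorem exists_sub_mul_generator {q : ℕ} (hq : 0 < q) (hA : BddBelow A) {x : ℤ} (hx : x ∈ A) :
    ∃ t : ℕ, x - t * q ∈ A ∧ x - t * q - q ∉ A := by
  obtain ⟨b, hb⟩ := hA
  by_contra hcon
  push Not at hcon
  have key : ∀ t : ℕ, x - t * q ∈ A := by
    intro t
    induction t with
    | zero => simpa using hx
    | succ t ih =>
      have := hcon t ih
      convert this using 1
      push_cast; ring
  have h1 := hb (key (x - b + 1).toNat)
  have h2 : b ≤ x := hb hx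
  rw [Int.toNat_of_nonneg (by omega)] at h1
  have : (1 : ℤ) ≤ q := by exact_mod_cast hq
  nlinarith

theorem exists_mem_rim_modEq (hn : 0 < n) (hmn : Nat.Coprime m n) (hA : IsInvariant n m A)
    (r : ℤ) : ∃ x ∈ rim n m A, ((n + m : ℕ) : ℤ) ∣ r - x := by
  obtain ⟨x, hx, hd⟩ := exists_mem_modEq_sum hn hmn hA r
  obtain ⟨t, h1, h2⟩ := exists_sub_mul_generator (q := n + m) (by omega) hA.bddBelow hx
  refine ⟨_, ⟨h1, by push_cast at h2 ⊢; exact h2⟩, ?_⟩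
  rw [← sub_add]
  exact hd.add (Dvd.intro_left _ rfl)

theorem mem_iff_exists_rim (hn : 0 < n) (hA : IsInvariant n m A) {y : ℤ} :
    y ∈ A ↔ ∃ x ∈ rim n m A, ∃ t : ℕ, y = x + t * (n + m) := by
  constructor
  · intro hy
    obtain ⟨t, h1, h2⟩ := exists_sub_mul_generator (q := n + m) (by omega) hA.bddBelow hy
    exact ⟨_, ⟨h1, by push_cast at h2 ⊢; exact h2⟩, t, by push_cast; ring⟩
  · rintro ⟨x, hx, t, rfl⟩
    exact hA.add_sum_mul hx.1 t

theorem eq_of_rim_subset (hn : 0 < n) (hmn : Nat.Coprime m n) (hA : IsInvariant n m A)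
    (hB : IsInvariant n m B) (h : rim n m A ⊆ rim n m B) : A = B := by
  have h' : rim n m B ⊆ rim n m A := by
    intro y hy
    obtain ⟨x, hx, hd⟩ := exists_mem_rim_modEq hn hmn hA y
    rwa [rim_eq_of_dvd hn hB hy (h hx) hd]
  ext y
  rw [mem_iff_exists_rim hn hA, mem_iff_exists_rim hn hB, h.antisymm h']

theorem below_trans (hB : IsInvariant n m A) (h1 : Below n m A B) (h2 : Below n m B C) :
    Below n m A C := by
  intro y hy
  have := hB.add_sum_mul (h1 _ (h2 y hy)) 1
  convert this using 1
  push_cast; ring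

theorem below_asymm (hn : 0 < n) (hA : IsInvariant n m A) (h1 : Below n m A B)
    (h2 : Below n m B A) : False := by
  obtain ⟨b, hb⟩ := hA.bddBelow
  obtain ⟨x, hx⟩ := hA.nonempty
  obtain ⟨t, h3, h4⟩ := exists_sub_mul_generator (q := n + m) (by omega) hA.bddBelow hx
  exact h4 (by have := below_trans hA h1 h2 _ h3; push_cast at this ⊢; exact this)

/-- `A` is below `B` exactly when no `n`-generator of `A` is sent into `B` by adding `m`; this is
the form in which `Below` occurs in the definition of suspicious numbers. -/
theorem below_iff_forall_generator (hn : 0 < n) (hmn : Nat.Coprime m n) (hA : IsInvariant n m A)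
    (hB : ∀ x ∈ B, x + n ∈ B) :
    Below n m A B ↔ ∀ x, x ∈ A → x - n ∉ A → x + m ∉ B := by
  constructor
  · intro h x _ hx' hxm
    apply hx'
    have := h _ hxm
    convert this using 1
    ring
  · intro h y hy
    obtain ⟨x, hx, c, hc⟩ := exists_mem_modEq_left hn hmn hA (y - m)
    obtain ⟨t, h1, h2⟩ := exists_sub_mul_generator hn hA.bddBelow hx
    have hn' : (0 : ℤ) < n := by exact_mod_cast hn
    -- the generator of `A` congruent to `y - m` is `g = x - t n`
    rcases le_or_gt 1 (c + t) with hct | hct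
    · have := hA.add_left_mul h1 (c + t - 1).toNat
      rw [Int.toNat_of_nonneg (by omega)] at this
      convert this using 1
      linear_combination hc
    · exfalso
      apply h _ h1 h2
      have key : ∀ k : ℕ, y + k * n ∈ B := by
        intro k
        induction k with
        | zero => simpa using hy
        | succ k ih =>
          have := hB _ ih
          convert this using 1
          push_cast; ring
      have := key (-(c + t)).toNat
      rw [Int.toNat_of_nonneg (by omega)] at this
      convert this using 1
      linear_combination -hc

/-! ### Heights of lattice words and loops -/

/-- The change of height along a step: `+m` for a vertical step and `-n` for a horizontal one. -/
def stepHeight (n m : ℕ) : LatticeStep → ℤ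
  | .V => m
  | .H => -n

/-- The height at which a walk starting at `0` ends. For `k > 0`, a word with `k * n` steps `V` and
`k * m` steps `H` is a Dyck path exactly when all of its prefixes have nonnegative height. -/
def height (n m : ℕ) (l : List LatticeStep) : ℤ := (l.map (stepHeight n m)).sum

@[simp] theorem height_nil : height n m [] = 0 := rfl

@[simp] theorem height_cons (a : LatticeStep) (l : List LatticeStep) :
    height n m (a :: l) = stepHeight n m a + height n m l := by simp [height]

@[simp] theorem height_append (l l' : List LatticeStep) :
    height n m (l ++ l') = height n m l + height n m l' := by simp [height]

theorem height_eq_count (l : List LatticeStep) :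
    height n m l = l.count .V * m - l.count .H * n := by
  induction l with
  | nil => simp
  | cons a l ih => cases a <;> simp [ih, stepHeight] <;> ring

theorem length_eq_count (l : List LatticeStep) : l.length = l.count .V + l.count .H := by
  induction l with
  | nil => simp
  | cons a l ih => cases a <;> simp [ih] <;> omega

/-- Since `-n ≡ m` modulo `n + m`, every step adds `m` to the height modulo `n + m`. -/
theorem dvd_height_sub (l : List LatticeStep) :
    ((n + m : ℕ) : ℤ) ∣ height n m l - l.length * m := by
  rw [height_eq_count, length_eq_count]
  exact ⟨-(l.count .H), by push_cast; ring⟩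

/-- `l` is the walk of length `n + m` which starts at height `x` and stays on the rim of `A`. -/
structure IsLoop (n m : ℕ) (A : Set ℤ) (x : ℤ) (l : List LatticeStep) : Prop where
  length_eq : l.length = n + m
  mem_rim : ∀ p, p <+: l → x + height n m p ∈ rim n m A

theorem add_right_mem_rim (hA : IsInvariant n m A) {y : ℤ} (hy : y ∈ rim n m A) (h : y - n ∉ A) :
    y + m ∈ rim n m A :=
  ⟨hA.add_right _ hy.1, fun h' => h (by convert h' using 1; ring)⟩

theorem sub_left_mem_rim (hA : IsInvariant n m A) {y : ℤ} (hy : y ∈ rim n m A) (h : y - n ∈ A) :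
    y - n ∈ rim n m A :=
  ⟨h, fun h' => hy.2 (by have := hA.add_left _ h'; convert this using 1; ring)⟩

theorem exists_walk_rim (hA : IsInvariant n m A) (k : ℕ) {x : ℤ} (hx : x ∈ rim n m A) :
    ∃ l : List LatticeStep, l.length = k ∧ ∀ p, p <+: l → x + height n m p ∈ rim n m A := by
  induction k generalizing x with
  | zero =>
    refine ⟨[], rfl, fun p hp => ?_⟩
    rw [List.prefix_nil.1 hp]; simpa using hx
  | succ k ih =>
    obtain ⟨a, ha⟩ : ∃ a, x + stepHeight n m a ∈ rim n m A := by
      by_cases h : x - n ∈ A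
      · exact ⟨.H, sub_left_mem_rim hA hx h⟩
      · exact ⟨.V, add_right_mem_rim hA hx h⟩
    obtain ⟨l, hl, hp⟩ := ih ha
    refine ⟨a :: l, by simp [hl], fun p hp' => ?_⟩
    rcases p with _ | ⟨b, p⟩
    · simpa using hx
    · obtain ⟨rfl, h⟩ := List.cons_prefix_cons.1 hp'
      simpa [add_assoc] using hp p h

theorem exists_isLoop (hA : IsInvariant n m A) {x : ℤ} (hx : x ∈ rim n m A) :
    ∃ l, IsLoop n m A x l := by
  obtain ⟨l, h1, h2⟩ := exists_walk_rim hA (n + m) hx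
  exact ⟨l, h1, h2⟩

/-- A walk on a rim is determined by its start and its length, as `y + m` and `y - n` are never
both on the rim. -/
theorem walk_rim_unique {x : ℤ} {l l' : List LatticeStep}
    (hlen : l.length = l'.length)
    (h : ∀ p, p <+: l → x + height n m p ∈ rim n m A)
    (h' : ∀ p, p <+: l' → x + height n m p ∈ rim n m A) : l = l' := by
  induction l generalizing l' x with
  | nil => simpa [eq_comm] using hlen
  | cons a l ih =>
    rcases l' with _ | ⟨b, l'⟩
    · simp at hlen
    have hab : a = b := by
      have h1 := h [a] (by simp)
      have h2 := h' [b] (by simp)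
      cases a <;> cases b <;> simp [stepHeight] at h1 h2 ⊢
      · exact h1.2 (by convert h2.1 using 1; ring)
      · exact h2.2 (by convert h1.1 using 1; ring)
    subst hab
    congr 1
    refine ih (x := x + stepHeight n m a) (by simpa using hlen) (fun p hp => ?_) (fun p hp => ?_)
    · simpa [add_assoc] using h (a :: p) (by simpa using hp)
    · simpa [add_assoc] using h' (a :: p) (by simpa using hp)

theorem IsLoop.unique {x : ℤ} {l l' : List LatticeStep}
    (h : IsLoop n m A x l) (h' : IsLoop n m A x l') : l = l' :=
  walk_rim_unique (h.length_eq.trans h'.length_eq.symm) h.mem_rim h'.mem_rim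

theorem IsLoop.height_eq_zero (hn : 0 < n) (hA : IsInvariant n m A) {x : ℤ}
    {l : List LatticeStep} (h : IsLoop n m A x l) : height n m l = 0 := by
  have h1 := h.mem_rim l List.prefix_rfl
  have h2 := h.mem_rim [] List.nil_prefix
  have h3 := dvd_height_sub (n := n) (m := m) l
  rw [h.length_eq] at h3
  have h4 : ((n + m : ℕ) : ℤ) ∣ height n m l :=
    (dvd_sub_left (Dvd.intro _ rfl)).1 h3
  have := rim_eq_of_dvd hn hA h1 h2 (by simpa using h4)
  simpa using this

/-- A loop of `A` visits the whole rim of `A`. -/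
theorem IsLoop.exists_prefix (hn : 0 < n) (hmn : Nat.Coprime m n) (hA : IsInvariant n m A) {x : ℤ}
    {l : List LatticeStep} (h : IsLoop n m A x l) {v : ℤ} (hv : v ∈ rim n m A) :
    ∃ p, p <+: l ∧ p ≠ l ∧ x + height n m p = v := by
  obtain ⟨t, ht, hd⟩ := exists_mul_modEq (k := n + m) (q := m) (by omega)
    (by simpa using hmn) (v - x)
  have hlen : (l.take t).length = t := by
    rw [List.length_take, h.length_eq]; omega
  refine ⟨l.take t, List.take_prefix _ _, fun he => ?_, ?_⟩
  · rw [he, h.length_eq] at hlen; omega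
  · refine rim_eq_of_dvd hn hA (h.mem_rim _ (List.take_prefix _ _)) hv ?_
    have h1 := dvd_height_sub (n := n) (m := m) (l.take t)
    rw [hlen] at h1
    have := h1.sub hd
    rwa [show height n m (l.take t) - t * m - (v - x - t * m) = x + height n m (l.take t) - v by
      ring] at this

theorem loop_counts (hn : 0 < n) {l : List LatticeStep} (hl : l.length = n + m)
    (h : height n m l = 0) : l.count .V = n ∧ l.count .H = m := by
  rw [height_eq_count] at h
  rw [length_eq_count] at hl
  have h1 : (l.count .V : ℤ) + l.count .H = n + m := by exact_mod_cast hl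
  have hN : (0 : ℤ) < n + m := by exact_mod_cast Nat.add_pos_left hn m
  have h2 : ((n : ℤ) + m) * (l.count .V - n) = 0 := by
    linear_combination h + n * h1
  have h3 : (l.count .V : ℤ) = n := by
    rcases mul_eq_zero.1 h2 with h | h <;> omega
  omega

/-- Invariant sets with disjoint rims are comparable. If some vertex of the rim of `B` lies in `A`,
then following the loop of `B` from there never leaves `A`; otherwise the rim of `B` avoids `A`. -/
theorem below_or_below_of_disjoint (hn : 0 < n) (hmn : Nat.Coprime m n) (hA : IsInvariant n m A)
    (hB : IsInvariant n m B) (h : Disjoint (rim n m A) (rim n m B)) :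
    Below n m A B ∨ Below n m B A := by
  have hdis : ∀ y ∈ rim n m B, y ∈ A → y - (n + m) ∈ A := fun y hy hyA => by
    by_contra hcon
    exact Set.disjoint_left.1 h ⟨hyA, hcon⟩ hy
  by_cases hex : ∃ y ∈ rim n m B, y ∈ A
  · left
    obtain ⟨y, hy, hyA⟩ := hex
    obtain ⟨l, hl⟩ := exists_isLoop hB hy
    -- a vertex of the rim of `B` inside `A` is inside `A + n + m`, so its successor is inside `A`
    have key : ∀ p, p <+: l → y + height n m p ∈ A := by
      intro p
      induction p using List.reverseRecOn with
      | nil => intro; simpa using hyA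
      | append_singleton p a ih =>
        intro hp
        have hp' : p <+: l := (List.prefix_append p [a]).trans hp
        have h1 := ih hp'
        have h2 := hdis _ (hl.mem_rim p hp') h1
        cases a
        · have := hA.add_right _ h1
          simpa [stepHeight, add_assoc] using this
        · have := hA.add_right _ h2
          convert this using 1
          simp [stepHeight]; ring
    intro z hz
    obtain ⟨x, hx, t, rfl⟩ := (mem_iff_exists_rim hn hB).1 hz
    obtain ⟨p, hp, -, rfl⟩ := hl.exists_prefix hn hmn hB hx
    have := hA.add_sum_mul (hdis _ hx (key p hp)) t
    convert this using 1
    ring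
  · right
    push Not at hex
    intro a ha
    obtain ⟨y, hy, c, hc⟩ := exists_mem_rim_modEq hn hmn hB a
    have hc' : 1 ≤ c := by
      by_contra hlt
      apply hex y hy
      have := hA.add_sum_mul ha (-c).toNat
      rw [Int.toNat_of_nonneg (by omega)] at this
      convert this using 1
      push_cast at hc
      linear_combination -hc
    have := hB.add_sum_mul hy.1 (c - 1).toNat
    rw [Int.toNat_of_nonneg (by omega)] at this
    convert this using 1
    push_cast at hc
    linear_combination hc

/-- The heights visited by the walk `l` from `x`, closed under adding `n + m`: the invariant set
whose loop is `l`, when `l` is closed of length `n + m`. -/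
def sweep (n m : ℕ) (x : ℤ) (l : List LatticeStep) : Set ℤ :=
  {y | ∃ p, p <+: l ∧ ∃ t : ℕ, y = x + height n m p + t * (n + m)}

theorem isInvariant_sweep (hn : 0 < n) {x : ℤ} {l : List LatticeStep} (hl : l.length = n + m)
    (h : height n m l = 0) : IsInvariant n m (sweep n m x l) := by
  refine ⟨⟨x, [], List.nil_prefix, 0, by simp⟩, ?_, ?_, ?_⟩
  · refine ⟨x - l.length * n, ?_⟩
    rintro y ⟨p, hp, t, rfl⟩
    rw [height_eq_count]
    have h1 : p.count .H ≤ l.length := (List.count_le_length).trans hp.length_le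
    have h2 : (p.count .H : ℤ) * n ≤ l.length * n := by exact_mod_cast Nat.mul_le_mul_right n h1
    have h3 : (0 : ℤ) ≤ p.count .V * m := by positivity
    have h4 : (0 : ℤ) ≤ t * (n + m) := by positivity
    linarith
  · rintro y ⟨p, hp, t, rfl⟩
    -- step back along the closed walk, from the end if `p` is empty
    obtain ⟨q, a, hq, hh⟩ : ∃ q a, (q ++ [a]) <+: l ∧ height n m (q ++ [a]) = height n m p := by
      rcases List.eq_nil_or_concat p with rfl | ⟨q, a, rfl⟩
      · rcases List.eq_nil_or_concat l with rfl | ⟨q, a, rfl⟩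
        · simp at hl; omega
        · refine ⟨q, a, by simp, ?_⟩
          simpa using h
      · exact ⟨q, a, by simpa using hp, by simp⟩
    rw [← hh]
    refine ⟨q, (List.prefix_append _ _).trans hq, ?_⟩
    cases a
    · exact ⟨t + 1, by simp [stepHeight]; ring⟩
    · exact ⟨t, by simp [stepHeight]; ring⟩
  · rintro y ⟨p, hp, t, rfl⟩
    obtain ⟨q, a, hq, hh⟩ : ∃ q a, (q ++ [a]) <+: l ∧ height n m q = height n m p := by
      obtain ⟨r, rfl⟩ := hp
      rcases r with _ | ⟨a, r⟩
      · rw [List.append_nil] at *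
        rcases p with _ | ⟨a, p⟩
        · simp at hl; omega
        · exact ⟨[], a, by simp, by rw [h]; simp⟩
      · exact ⟨p, a, ⟨r, by simp⟩, rfl⟩
    rw [← hh]
    refine ⟨q ++ [a], hq, ?_⟩
    cases a
    · exact ⟨t, by simp [stepHeight]; ring⟩
    · exact ⟨t + 1, by simp [stepHeight]; ring⟩

theorem isLoop_sweep (hn : 0 < n) (hmn : Nat.Coprime m n) {x : ℤ} {l : List LatticeStep}
    (hl : l.length = n + m) (h : height n m l = 0) : IsLoop n m (sweep n m x l) x l := by
  refine ⟨hl, fun p hp => ⟨⟨p, hp, 0, by simp⟩, ?_⟩⟩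
  rintro ⟨q, hq, t, ht⟩
  have hN : (0 : ℤ) < n + m := by exact_mod_cast Nat.add_pos_left hn m
  have h1 := dvd_height_sub (n := n) (m := m) p
  have h2 := dvd_height_sub (n := n) (m := m) q
  have h3 : height n m p - height n m q = (t + 1) * (n + m) := by linear_combination ht
  -- the lengths of `p` and `q` agree modulo `n + m`
  have h4 : ((n + m : ℕ) : ℤ) ∣ ((p.length : ℤ) - q.length) * m := by
    have h5 : ((n + m : ℕ) : ℤ) ∣ height n m p - height n m q :=
      ⟨t + 1, by rw [h3]; push_cast; ring⟩
    have := (h5.sub h1).add h2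
    rwa [show height n m p - height n m q - (height n m p - p.length * m) +
      (height n m q - q.length * m) = ((p.length : ℤ) - q.length) * m by ring] at this
  have h6 : ((n + m : ℕ) : ℤ) ∣ (p.length : ℤ) - q.length := by
    refine IsCoprime.dvd_of_dvd_mul_right ?_ h4
    rw [Nat.isCoprime_iff_coprime]
    simpa [Nat.coprime_comm] using hmn
  have hp1 := hp.length_le
  have hq1 := hq.length_le
  have hcase : p.length = q.length ∨ (p = l ∧ q = []) ∨ (p = [] ∧ q = l) := by
    obtain ⟨c, hc⟩ := h6
    push_cast at hc
    have hlz : (p.length : ℤ) ≤ n + m := by exact_mod_cast hl ▸ hp1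
    have hlz' : (q.length : ℤ) ≤ n + m := by exact_mod_cast hl ▸ hq1
    have c1 : c ≤ 1 := by nlinarith
    have c2 : -1 ≤ c := by nlinarith
    obtain rfl | rfl | rfl : c = -1 ∨ c = 0 ∨ c = 1 := by omega
    · right; right
      exact ⟨List.length_eq_zero_iff.1 (by omega), hq.eq_of_length (by omega)⟩
    · left; omega
    · right; left
      exact ⟨hp.eq_of_length (by omega), List.length_eq_zero_iff.1 (by omega)⟩
  have h0 : height n m p = height n m q := by
    rcases hcase with he | ⟨rfl, rfl⟩ | ⟨rfl, rfl⟩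
    · rw [List.prefix_of_prefix_length_le hp hq he.le |>.eq_of_length he]
    · simpa using h
    · simpa using h.symm
  rw [h0, sub_self] at h3
  have : (0 : ℤ) < (t + 1) * (n + m) := by positivity
  omega

/-! ### Splicing loops into walks -/

/-- `D` is obtained from `D'` by inserting the loop of `A` where `D'` first visits the rim of `A`.
Equivalently, the loop of `A` can be removed from `D`, leaving `D'`. -/
def Splice (n m : ℕ) (A : Set ℤ) (D' D : List LatticeStep) : Prop :=
  ∃ α l β, D' = α ++ β ∧ D = α ++ (l ++ β) ∧ IsLoop n m A (height n m α) l ∧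
    ∀ p, p <+: α → p ≠ α → height n m p ∉ rim n m A

theorem IsLoop.start_mem {x : ℤ} {l : List LatticeStep} (h : IsLoop n m A x l) :
    x ∈ rim n m A := by simpa using h.mem_rim [] List.nil_prefix

theorem prefix_append_cases {α : Type*} {p a b : List α} (h : p <+: a ++ b) :
    p <+: a ∧ p ≠ a ∨ ∃ q, q <+: b ∧ p = a ++ q := by
  obtain ⟨r, hr⟩ := h
  rcases List.append_eq_append_iff.1 hr with ⟨c, rfl, -⟩ | ⟨c, rfl, rfl⟩
  · rcases eq_or_ne c [] with rfl | hc
    · exact Or.inr ⟨[], List.nil_prefix, by simp⟩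
    · exact Or.inl ⟨List.prefix_append _ _, by simpa using hc⟩
  · exact Or.inr ⟨c, List.prefix_append _ _, rfl⟩

/-- The first visit of a walk to a rim is unique. -/
theorem first_visit_unique {D α α' : List LatticeStep} (h : α <+: D) (h' : α' <+: D)
    (hα : height n m α ∈ rim n m A) (hα' : height n m α' ∈ rim n m A)
    (hf : ∀ p, p <+: α → p ≠ α → height n m p ∉ rim n m A)
    (hf' : ∀ p, p <+: α' → p ≠ α' → height n m p ∉ rim n m A) : α = α' := by
  by_contra hne
  rcases List.prefix_or_prefix_of_prefix h h' with hp | hp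
  · exact hf' _ hp hne hα
  · exact hf _ hp (Ne.symm hne) hα'

theorem Splice.inner_unique {D D₁ D₂ : List LatticeStep}
    (h₁ : Splice n m A D₁ D) (h₂ : Splice n m A D₂ D) : D₁ = D₂ := by
  obtain ⟨α, l, β, rfl, hD, hl, hf⟩ := h₁
  obtain ⟨α', l', β', rfl, hD', hl', hf'⟩ := h₂
  obtain rfl := first_visit_unique ⟨_, hD.symm⟩ ⟨_, hD'.symm⟩ hl.start_mem hl'.start_mem hf hf'
  obtain rfl := hl.unique hl'
  rw [hD] at hD'
  simpa using hD'

theorem Splice.outer_unique {D' D₁ D₂ : List LatticeStep}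
    (h₁ : Splice n m A D' D₁) (h₂ : Splice n m A D' D₂) : D₁ = D₂ := by
  obtain ⟨α, l, β, hD, rfl, hl, hf⟩ := h₁
  obtain ⟨α', l', β', hD', rfl, hl', hf'⟩ := h₂
  obtain rfl := first_visit_unique ⟨_, hD.symm⟩ ⟨_, hD'.symm⟩ hl.start_mem hl'.start_mem hf hf'
  obtain rfl := hl.unique hl'
  rw [hD] at hD'
  simpa using hD'

theorem exists_splice (hA : IsInvariant n m A) {D' : List LatticeStep}
    (h : ∃ p, p <+: D' ∧ height n m p ∈ rim n m A) : ∃ D, Splice n m A D' D := by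
  classical
  have hex : ∃ k, height n m (D'.take k) ∈ rim n m A := by
    obtain ⟨p, hp, hpA⟩ := h
    exact ⟨p.length, by rwa [← List.prefix_iff_eq_take.1 hp]⟩
  obtain ⟨l, hl⟩ := exists_isLoop hA (Nat.find_spec hex)
  refine ⟨_, D'.take (Nat.find hex), l, D'.drop (Nat.find hex), by simp, rfl, hl, ?_⟩
  intro p hp hne hpA
  have hlt : p.length < (D'.take (Nat.find hex)).length :=
    lt_of_le_of_ne hp.length_le fun he => hne (hp.eq_of_length he)
  rw [List.length_take] at hlt
  refine Nat.find_min hex (m := p.length) (by omega) ?_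
  rwa [← List.prefix_iff_eq_take.1 (hp.trans (List.take_prefix _ _))]

/-- Different removable loops of a walk are disjoint, and removing one keeps the other removable.
-/
theorem Splice.diamond (hn : 0 < n) (hmn : Nat.Coprime m n) (hA : IsInvariant n m A)
    (hB : IsInvariant n m B) {D D₁ D₂ : List LatticeStep}
    (h₁ : Splice n m A D₁ D) (h₂ : Splice n m B D₂ D) (hne : A ≠ B) :
    Disjoint (rim n m A) (rim n m B) ∧ ∃ D₀, Splice n m A D₀ D₂ ∧ Splice n m B D₀ D₁ := by
  have main : ∀ {A B : Set ℤ}, IsInvariant n m A → IsInvariant n m B → A ≠ B →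
      ∀ {α l β α' l' β' γ : List LatticeStep}, α' = α ++ γ →
      α ++ (l ++ β) = α' ++ (l' ++ β') →
      IsLoop n m A (height n m α) l → IsLoop n m B (height n m α') l' →
      (∀ p, p <+: α → p ≠ α → height n m p ∉ rim n m A) →
      (∀ p, p <+: α' → p ≠ α' → height n m p ∉ rim n m B) →
      Disjoint (rim n m A) (rim n m B) ∧
        ∃ D₀, Splice n m A D₀ (α' ++ β') ∧ Splice n m B D₀ (α ++ β) := by
    intro A B hA hB hne α l β α' l' β' γ hγ hD hl hl' hf hf'
    subst hγ
    rw [List.append_assoc, List.append_cancel_left_eq] at hD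
    have hl0 := hl.height_eq_zero hn hA
    obtain ⟨δ, rfl, rfl⟩ : ∃ δ, γ = l ++ δ ∧ β = δ ++ (l' ++ β') := by
      rcases List.append_eq_append_iff.1 hD with ⟨δ, rfl, rfl⟩ | ⟨δ, rfl, hδ⟩
      · exact ⟨δ, rfl, rfl⟩
      · exfalso
        have hlen : δ <+: l' := by
          refine List.prefix_of_prefix_length_le ⟨_, hδ.symm⟩ (List.prefix_append _ _) ?_
          have h1 := hl.length_eq
          have h2 := hl'.length_eq
          rw [List.length_append] at h1
          omega
        have h3 := hl'.mem_rim _ hlen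
        rw [height_append, add_assoc, ← height_append, hl0, add_zero] at h3
        rcases eq_or_ne γ [] with rfl | hγ
        · -- both loops start at the same position, so they are equal as words
          have : δ = l' := hlen.eq_of_length (by
            have h1 := hl.length_eq
            have h2 := hl'.length_eq
            rw [List.nil_append] at h1
            omega)
          subst this
          simp only [List.append_nil, List.nil_append] at hl hl'
          refine hne (eq_of_rim_subset hn hmn hA hB fun v hv => ?_)
          obtain ⟨p, hp, -, rfl⟩ := hl.exists_prefix hn hmn hA hv
          exact hl'.mem_rim p hp
        · exact hf' α (List.prefix_append _ _) (by simpa using hγ) h3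
    have hdis : Disjoint (rim n m A) (rim n m B) := by
      rw [Set.disjoint_left]
      intro v hvA hvB
      obtain ⟨p, hp, hpl, rfl⟩ := hl.exists_prefix hn hmn hA hvA
      rw [← height_append] at hvB
      refine hf' (α ++ p) ?_ ?_ hvB
      · rw [List.prefix_append_right_inj]
        exact hp.trans (List.prefix_append _ _)
      · intro he
        rw [List.append_cancel_left_eq] at he
        have h1 := congrArg List.length he
        rw [List.length_append] at h1
        exact hpl (hp.eq_of_length (le_antisymm hp.length_le (by omega)))
    refine ⟨hdis, α ++ (δ ++ β'), ⟨α, l, δ ++ β', rfl, by simp, hl, hf⟩,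
      ⟨α ++ δ, l', β', by simp, by simp, ?_, ?_⟩⟩
    · simpa [hl0] using hl'
    · intro p hp hpne
      rcases prefix_append_cases hp with ⟨hp, hpα⟩ | ⟨q, hq, rfl⟩
      · refine hf' p (hp.trans (List.prefix_append _ _)) fun he => ?_
        subst he
        have h1 := hp.length_le
        have h2 := hl.length_eq
        simp only [List.length_append] at h1
        omega
      · have := hf' (α ++ (l ++ q)) (by simpa using hq) (by simpa using hpne)
        simpa [hl0] using this
  obtain ⟨α, l, β, rfl, hD, hl, hf⟩ := h₁
  obtain ⟨α', l', β', rfl, hD', hl', hf'⟩ := h₂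
  rcases List.prefix_or_prefix_of_prefix (l₁ := α) (l₂ := α') (l₃ := D) ⟨_, hD.symm⟩
    ⟨_, hD'.symm⟩ with ⟨γ, hγ⟩ | ⟨γ, hγ⟩
  · exact main hA hB hne hγ.symm (hD.symm.trans hD') hl hl' hf hf'
  · obtain ⟨h1, D₀, h2, h3⟩ := main hB hA hne.symm hγ.symm (hD'.symm.trans hD) hl' hl hf' hf
    exact ⟨h1.symm, D₀, h3, h2⟩

/-- If the loop of `B` is disjoint from the loop of `A` inserted after it, then it remains
removable. -/
theorem Splice.commute (hn : 0 < n) (hA : IsInvariant n m A)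
    {D₀ D' D : List LatticeStep} (hdis : Disjoint (rim n m A) (rim n m B))
    (h₁ : Splice n m B D₀ D') (h₂ : Splice n m A D' D) : ∃ D₁, Splice n m B D₁ D := by
  obtain ⟨α, l, β, rfl, rfl, hl, hf⟩ := h₁
  obtain ⟨α', l', β', hD, rfl, hl', hf'⟩ := h₂
  have hnot : ∀ v, v ∈ rim n m A → v ∉ rim n m B := fun v hv =>
    Set.disjoint_left.1 hdis hv
  have hl0 := hl'.height_eq_zero hn hA
  rcases List.append_eq_append_iff.1 hD with ⟨γ, rfl, hγ⟩ | ⟨γ, rfl, rfl⟩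
  · rcases List.append_eq_append_iff.1 hγ with ⟨δ, rfl, rfl⟩ | ⟨δ, rfl, rfl⟩
    · exact ⟨_, α, l, δ ++ (l' ++ β'), rfl, by simp, hl, hf⟩
    · exfalso
      have := hl.mem_rim γ (List.prefix_append _ _)
      rw [← height_append] at this
      exact hnot _ hl'.start_mem this
  · refine ⟨_, α' ++ (l' ++ γ), l, β, rfl, by simp, by simpa [hl0] using hl, fun p hp hpne => ?_⟩
    rcases prefix_append_cases hp with ⟨hp, hpα⟩ | ⟨q, hq, rfl⟩
    · refine hf p (hp.trans (List.prefix_append _ _)) fun he => hpα (hp.eq_of_length ?_)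
      have h1 := hp.length_le
      have h2 := congrArg List.length he
      rw [List.length_append] at h2
      omega
    · rcases prefix_append_cases hq with ⟨hq, -⟩ | ⟨r, hr, rfl⟩
      · rw [height_append]
        exact hnot _ (hl'.mem_rim q hq)
      · have := hf (α' ++ r) (by simpa using hr) (by simpa using hpne)
        simpa [hl0] using this

/-- The vertices of a walk after splicing in a loop: the old ones and the rim. -/
theorem Splice.exists_prefix_right (hn : 0 < n) (hmn : Nat.Coprime m n) (hA : IsInvariant n m A)
    {D' D : List LatticeStep} (h : Splice n m A D' D) {v : ℤ} :
    (∃ p, p <+: D ∧ height n m p = v) ↔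
      (∃ p, p <+: D' ∧ height n m p = v) ∨ v ∈ rim n m A := by
  obtain ⟨α, l, β, rfl, rfl, hl, -⟩ := h
  have hl0 := hl.height_eq_zero hn hA
  constructor
  · rintro ⟨p, hp, rfl⟩
    rcases prefix_append_cases hp with ⟨hp, -⟩ | ⟨q, hq, rfl⟩
    · exact Or.inl ⟨p, hp.trans (List.prefix_append _ _), rfl⟩
    · rcases prefix_append_cases hq with ⟨hq, -⟩ | ⟨r, hr, rfl⟩
      · right
        rw [height_append]
        exact hl.mem_rim q hq
      · exact Or.inl ⟨α ++ r, by simpa using hr, by simp [hl0]⟩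
  · rintro (⟨p, hp, rfl⟩ | hv)
    · rcases prefix_append_cases hp with ⟨hp, -⟩ | ⟨q, hq, rfl⟩
      · exact ⟨p, hp.trans (List.prefix_append _ _), rfl⟩
      · exact ⟨α ++ (l ++ q), by simpa using hq, by simp [hl0]⟩
    · obtain ⟨p, hp, -, rfl⟩ := hl.exists_prefix hn hmn hA hv
      exact ⟨α ++ p, (List.prefix_append_right_inj _).2 (hp.trans (List.prefix_append _ _)),
        by simp⟩

theorem Splice.counts (hn : 0 < n) (hA : IsInvariant n m A) {D' D : List LatticeStep}
    (h : Splice n m A D' D) :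
    D.count .V = D'.count .V + n ∧ D.count .H = D'.count .H + m := by
  obtain ⟨α, l, β, rfl, rfl, hl, -⟩ := h
  obtain ⟨h1, h2⟩ := loop_counts hn hl.length_eq (hl.height_eq_zero hn hA)
  simp only [List.count_append, h1, h2]
  omega

/-! ### Every closed walk contains a removable loop -/

/-- A discrete intermediate value theorem for integer sequences with increments at most `1`. -/
theorem exists_zero_of_steps {f : ℕ → ℤ} {a b : ℕ} (hab : a ≤ b)
    (hstep : ∀ i, a ≤ i → i < b → |f (i + 1) - f i| ≤ 1)
    (h : 0 ≤ f a ∧ f b ≤ 0 ∨ f a ≤ 0 ∧ 0 ≤ f b) : ∃ c, a ≤ c ∧ c ≤ b ∧ f c = 0 := by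
  wlog h' : 0 ≤ f a ∧ f b ≤ 0 generalizing f
  · obtain ⟨c, h1, h2, h3⟩ := this (f := fun i => -f i)
      (fun i hi hi' => by
        have := hstep i hi hi'
        rw [abs_le] at this ⊢
        constructor <;> linarith)
      (by simpa using h.symm) (by simpa using h.resolve_left h')
    exact ⟨c, h1, h2, by simpa using h3⟩
  induction b, hab using Nat.le_induction with
  | base => exact ⟨a, le_rfl, le_rfl, by omega⟩
  | succ b hab ih =>
    by_cases hb : f b ≤ 0
    · obtain ⟨c, h1, h2, h3⟩ := ih (fun i hi hi' => hstep i hi (by omega)) (Or.inl ⟨h'.1, hb⟩)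
        ⟨h'.1, hb⟩
      exact ⟨c, h1, by omega, h3⟩
    · have := hstep b hab (by omega)
      rw [abs_le] at this
      exact ⟨b + 1, by omega, le_rfl, by omega⟩

theorem exists_nonpos_of_sum_eq_zero {k : ℕ} (hk : 0 < k) {g : ℕ → ℤ}
    (h : ∑ t ∈ Finset.range k, g t = 0) :
    (∃ t < k, g t ≤ 0) ∧ ∃ t < k, 0 ≤ g t := by
  constructor
  · by_contra hcon
    push Not at hcon
    have : 0 < ∑ t ∈ Finset.range k, g t :=
      Finset.sum_pos (fun t ht => hcon t (Finset.mem_range.1 ht)) ⟨0, Finset.mem_range.2 hk⟩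
    omega
  · by_contra hcon
    push Not at hcon
    have : ∑ t ∈ Finset.range k, g t < 0 :=
      Finset.sum_neg (fun t ht => hcon t (Finset.mem_range.1 ht)) ⟨0, Finset.mem_range.2 hk⟩
    omega

/-- A non-empty closed walk contains a closed window of length exactly `n + m`. The number of
vertical steps in a window of that length changes by at most `1` when the window moves by one step,
and its average over consecutive windows is `n`. -/
theorem exists_closed_window (hn : 0 < n) (hmn : Nat.Coprime m n) {u : List LatticeStep}
    (hu : u ≠ []) (h : height n m u = 0) :
    ∃ a l b, u = a ++ (l ++ b) ∧ l.length = n + m ∧ height n m l = 0 := by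
  have hN : (0 : ℤ) < ((n + m : ℕ) : ℤ) := by exact_mod_cast Nat.add_pos_left hn m
  obtain ⟨k, hk⟩ : n + m ∣ u.length := by
    have h1 := dvd_height_sub (n := n) (m := m) u
    rw [h, zero_sub, dvd_neg] at h1
    have h2 : (n + m) ∣ u.length * m := by exact_mod_cast h1
    exact Nat.Coprime.dvd_of_dvd_mul_right (by simpa [Nat.coprime_comm] using hmn) h2
  have hk0 : 0 < k := by
    rcases Nat.eq_zero_or_pos k with rfl | hk0
    · exact absurd (List.length_eq_zero_iff.1 (by simpa using hk)) hu
    · exact hk0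
  -- `g i` is the number of vertical steps in the first `i` steps
  set g : ℕ → ℤ := fun i => ((u.take i).count .V : ℤ) with hg
  set f : ℕ → ℤ := fun i => g (i + (n + m)) - g i - n with hf
  have hgstep : ∀ i, g i ≤ g (i + 1) ∧ g (i + 1) ≤ g i + 1 := by
    intro i
    simp only [hg]
    rw [List.take_add_one, List.count_append]
    have : (u[i]?.toList).count LatticeStep.V ≤ 1 := by
      refine List.count_le_length.trans ?_
      cases u[i]? <;> simp
    push_cast
    omega
  have hsum : ∑ t ∈ Finset.range k, f (t * (n + m)) = 0 := by
    have h1 : ∀ t : ℕ, f (t * (n + m)) = g ((t + 1) * (n + m)) - g (t * (n + m)) - n := by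
      intro t
      simp only [hf]
      rw [Nat.succ_mul]
    simp only [h1]
    rw [Finset.sum_sub_distrib, Finset.sum_range_sub (fun t => g (t * (n + m)))]
    have h2 : g (k * (n + m)) = u.count .V := by
      simp only [hg]
      rw [List.take_of_length_le (by rw [hk, mul_comm])]
    have h3 : g (0 * (n + m)) = 0 := by simp [hg]
    rw [h2, h3]
    simp only [Finset.sum_const, Finset.card_range, nsmul_eq_mul, sub_zero]
    rw [height_eq_count] at h
    rw [length_eq_count] at hk
    have hk' : (u.count .V : ℤ) + u.count .H = (n + m) * k := by exact_mod_cast hk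
    have h4 : ((n : ℤ) + m) * (u.count .V - k * n) = 0 := by
      linear_combination h + n * hk'
    rcases mul_eq_zero.1 h4 with h | h
    · push_cast at hN; omega
    · exact h
  obtain ⟨⟨t, ht, ht0⟩, ⟨t', ht', ht0'⟩⟩ := exists_nonpos_of_sum_eq_zero hk0 hsum
  have hstep : ∀ i, |f (i + 1) - f i| ≤ 1 := by
    intro i
    have h1 := hgstep i
    have h2 := hgstep (i + (n + m))
    simp only [hf]
    rw [show i + 1 + (n + m) = i + (n + m) + 1 by ring, abs_le]
    constructor <;> linarith
  obtain ⟨c, hc, hfc⟩ : ∃ c, c + (n + m) ≤ u.length ∧ f c = 0 := by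
    have hbd : ∀ j, j < k → ∀ c, c ≤ j * (n + m) → c + (n + m) ≤ u.length := by
      intro j hj c hc
      rw [hk, mul_comm]
      calc c + (n + m) ≤ j * (n + m) + (n + m) := by omega
        _ = (j + 1) * (n + m) := by ring
        _ ≤ k * (n + m) := Nat.mul_le_mul_right _ hj
    rcases le_total t t' with htt | htt
    · obtain ⟨c, -, h2, h3⟩ := exists_zero_of_steps (f := f)
        (Nat.mul_le_mul_right (n + m) htt) (fun i _ _ => hstep i) (Or.inr ⟨ht0, ht0'⟩)
      exact ⟨c, hbd t' ht' c h2, h3⟩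
    · obtain ⟨c, -, h2, h3⟩ := exists_zero_of_steps (f := f)
        (Nat.mul_le_mul_right (n + m) htt) (fun i _ _ => hstep i) (Or.inl ⟨ht0', ht0⟩)
      exact ⟨c, hbd t ht c h2, h3⟩
  have hlen : ((u.drop c).take (n + m)).length = n + m := by
    rw [List.length_take, List.length_drop]; omega
  refine ⟨u.take c, (u.drop c).take (n + m), (u.drop c).drop (n + m), by simp, hlen, ?_⟩
  have h1 : (((u.drop c).take (n + m)).count .V : ℤ) = n := by
    have : u.take (c + (n + m)) = u.take c ++ (u.drop c).take (n + m) := List.take_add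
    simp only [hf, hg, this, List.count_append] at hfc
    push_cast at hfc
    linarith
  rw [length_eq_count] at hlen
  have h2 : (((u.drop c).take (n + m)).count .H : ℤ) = m := by omega
  rw [height_eq_count, h1, h2]
  ring

theorem exists_splice_of_closed (hn : 0 < n) (hmn : Nat.Coprime m n) {D : List LatticeStep}
    (hD : D ≠ []) (h : height n m D = 0) :
    ∃ A D', IsInvariant n m A ∧ Splice n m A D' D := by
  classical
  -- the shortest prefix of `D` that ends with a closed window of length `n + m`
  have hex : ∃ k, ∃ a l b, D = a ++ (l ++ b) ∧ l.length = n + m ∧ height n m l = 0 ∧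
      a.length = k := by
    obtain ⟨a, l, b, h1, h2, h3⟩ := exists_closed_window hn hmn hD h
    exact ⟨_, a, l, b, h1, h2, h3, rfl⟩
  obtain ⟨a, l, b, rfl, hl, hl0, hlen⟩ := Nat.find_spec hex
  refine ⟨_, a ++ b, isInvariant_sweep (x := height n m a) hn hl hl0, a, l, b, rfl, rfl,
    isLoop_sweep hn hmn hl hl0, fun p hp hpa hmem => ?_⟩
  -- a rim vertex met before the window closes up a walk with an earlier closed window
  obtain ⟨q, hq, hql, hqe⟩ := (isLoop_sweep hn hmn hl hl0).exists_prefix hn hmn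
    (isInvariant_sweep (x := height n m a) hn hl hl0) hmem
  obtain ⟨c, rfl⟩ := hp
  obtain ⟨r, rfl⟩ := hq
  have hr : r ≠ [] := fun hr => hql (by simp [hr])
  obtain ⟨a', l', b', h1, h2, h3⟩ := exists_closed_window hn hmn (u := c ++ q)
    (by
      intro hc
      apply hpa
      rw [(List.append_eq_nil_iff.1 hc).1, List.append_nil])
    (by rw [height_append] at hqe ⊢; linarith)
  refine Nat.find_min hex (m := (p ++ a').length) ?_
    ⟨p ++ a', l', b' ++ (r ++ b), ?_, h2, h3, rfl⟩
  · rw [← hlen]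
    have h4 := congrArg List.length h1
    have h5 := List.length_pos_iff.2 hr
    simp only [List.length_append] at h4 hl ⊢
    omega
  · have : p ++ c ++ (q ++ r ++ b) = p ++ ((c ++ q) ++ (r ++ b)) := by simp
    rw [this, h1]
    simp

/-! ### Words of invariant sets and Dyck paths -/

/-- `Builds n m v D`: the walk `D` arises from the empty walk by splicing in the loops of the
members of `v`, starting with the last one. All members are invariant sets of nonnegative integers,
and none is below the one spliced in next. The list is thus a word read from right to left. -/
inductive Builds (n m : ℕ) : List (Set ℤ) → List LatticeStep → Prop
  | nil : Builds n m [] []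
  | cons {A : Set ℤ} {v : List (Set ℤ)} {D' D : List LatticeStep} (hv : Builds n m v D')
      (hA : IsInvariant n m A) (hpos : ∀ x ∈ A, 0 ≤ x) (hhead : ∀ B ∈ v.head?, ¬ Below n m B A)
      (hs : Splice n m A D' D) : Builds n m (A :: v) D

theorem Builds.functional {v : List (Set ℤ)} {D₁ D₂ : List LatticeStep} (h₁ : Builds n m v D₁)
    (h₂ : Builds n m v D₂) : D₁ = D₂ := by
  induction h₁ generalizing D₂ with
  | nil => cases h₂; rfl
  | cons hv hA hpos hhead hs ih =>
    cases h₂ with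
    | cons hv' _ _ _ hs' =>
      obtain rfl := ih hv'
      exact hs.outer_unique hs'

theorem Builds.height_nonneg (hn : 0 < n) (hmn : Nat.Coprime m n) {v : List (Set ℤ)}
    {D : List LatticeStep} (h : Builds n m v D) {p : List LatticeStep} (hp : p <+: D) :
    0 ≤ height n m p := by
  induction h generalizing p with
  | nil => rw [List.prefix_nil.1 hp]; simp
  | cons hv hA hpos hhead hs ih =>
    rcases (hs.exists_prefix_right hn hmn hA).1 ⟨p, hp, rfl⟩ with ⟨q, hq, h⟩ | h
    · exact h ▸ ih hq
    · exact hpos _ h.1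

theorem Builds.counts (hn : 0 < n) {v : List (Set ℤ)} {D : List LatticeStep}
    (h : Builds n m v D) : D.count .V = v.length * n ∧ D.count .H = v.length * m := by
  induction h with
  | nil => simp
  | cons hv hA hpos hhead hs ih =>
    obtain ⟨h1, h2⟩ := hs.counts hn hA
    rw [h1, h2, ih.1, ih.2, List.length_cons]
    constructor <;> ring

theorem Builds.exists_prefix (hn : 0 < n) (hmn : Nat.Coprime m n) {v : List (Set ℤ)}
    {D : List LatticeStep} (h : Builds n m v D) {B : Set ℤ} (hB : B ∈ v) {x : ℤ}
    (hx : x ∈ rim n m B) : ∃ p, p <+: D ∧ height n m p = x := by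
  induction h with
  | nil => simp at hB
  | cons hv hA hpos hhead hs ih =>
    rw [hs.exists_prefix_right hn hmn hA]
    rcases List.mem_cons.1 hB with rfl | hB
    · exact Or.inr hx
    · exact Or.inl (ih hB)

theorem Builds.inv {v : List (Set ℤ)} {D : List LatticeStep} (h : Builds n m v D) :
    ∀ A ∈ v, IsInvariant n m A := by
  induction h with
  | nil => simp
  | cons hv hA hpos hhead hs ih =>
    simpa using ⟨hA, ih⟩

theorem Builds.nonneg {v : List (Set ℤ)} {D : List LatticeStep} (h : Builds n m v D) :
    ∀ A ∈ v, ∀ x ∈ A, 0 ≤ x := by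
  induction h with
  | nil => simp
  | cons hv hA hpos hhead hs ih =>
    simpa using ⟨hpos, ih⟩

/-- The loop spliced in last is the lowest removable loop. -/
theorem Builds.head_lowest (hn : 0 < n) (hmn : Nat.Coprime m n) {v : List (Set ℤ)}
    {D D' : List LatticeStep} (h : Builds n m v D) (hA : IsInvariant n m A)
    (hs : Splice n m A D' D) : ∃ B ∈ v.head?, A = B ∨ Below n m B A := by
  induction h generalizing D' with
  | nil =>
    exfalso
    obtain ⟨α, l, β, -, h, hl, -⟩ := hs
    have h1 := congrArg List.length h
    have h2 := hl.length_eq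
    simp only [List.length_append, List.length_nil] at h1
    omega
  | @cons B v D₁ D hv hB hpos hhead hs' ih =>
    refine ⟨B, by simp, ?_⟩
    by_contra! hcon
    obtain ⟨hdis, D₀, h1, -⟩ := hs.diamond hn hmn hA hB hs' hcon.1
    have hAB := (below_or_below_of_disjoint hn hmn hA hB hdis).resolve_right hcon.2
    obtain ⟨C, hC, hAC⟩ := ih h1
    refine hhead C hC ?_
    rcases hAC with rfl | hAC
    · exact hAB
    · exact below_trans (hv.inv C (List.mem_of_mem_head? hC)) hAC hAB

theorem Builds.injective (hn : 0 < n) (hmn : Nat.Coprime m n) {v₁ v₂ : List (Set ℤ)}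
    {D : List LatticeStep} (h₁ : Builds n m v₁ D) (h₂ : Builds n m v₂ D) : v₁ = v₂ := by
  induction h₁ generalizing v₂ with
  | nil =>
    cases h₂ with
    | nil => rfl
    | cons _ hA _ _ hs => simpa using Builds.head_lowest hn hmn .nil hA hs
  | @cons A v D₁ D hv hA hpos hhead hs ih =>
    cases h₂ with
    | nil => simpa using Builds.head_lowest hn hmn .nil hA hs
    | @cons B v' D₂ _ hv' hB hpos' hhead' hs' =>
      have h1 := (Builds.cons hv hA hpos hhead hs).head_lowest hn hmn hB hs'
      have h2 := (Builds.cons hv' hB hpos' hhead' hs').head_lowest hn hmn hA hs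
      simp only [List.head?_cons, Option.mem_def, Option.some.injEq, exists_eq_left'] at h1 h2
      obtain rfl : A = B := by
        rcases h1 with h1 | h1
        · exact h1.symm
        · rcases h2 with h2 | h2
          · exact h2
          · exact (below_asymm hn hA h1 h2).elim
      obtain rfl := hs.inner_unique hs'
      rw [ih hv']

/-- A set which may be added to a non-empty word shares a rim vertex with a member of the word: if
not, it would be below all members, since each member in turn is not below the next one, but the
first member contains `0`. -/
theorem Builds.exists_common_vertex (hn : 0 < n) (hmn : Nat.Coprime m n) {v : List (Set ℤ)}
    {D : List LatticeStep} (h : Builds n m v D) (hv : v ≠ []) (hA : IsInvariant n m A)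
    (hpos : ∀ x ∈ A, 0 ≤ x) (hhead : ∀ B ∈ v.head?, ¬ Below n m B A) :
    ∃ B ∈ v, ¬ Disjoint (rim n m B) (rim n m A) := by
  induction h with
  | nil => exact absurd rfl hv
  | @cons B v D₁ D hw hB hposB hheadB hs ih =>
    by_contra! hcon
    have hAB : Below n m A B := by
      refine (below_or_below_of_disjoint hn hmn hB hA (hcon B (by simp))).resolve_left ?_
      exact hhead B (by simp)
    rcases v with _ | ⟨C, v⟩
    · -- the first set of the word contains `0`, so no set of natural numbers lies below it
      cases hw
      obtain ⟨α, l, β, h, -, hl, -⟩ := hs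
      obtain ⟨rfl, rfl⟩ := List.append_eq_nil_iff.1 h.symm
      have := hpos _ (hAB _ hl.start_mem.1)
      simp at this
      omega
    · obtain ⟨E, hE, hEA⟩ := ih (by simp) fun E hE hEA =>
        hheadB E hE (below_trans (hw.inv E (List.mem_of_mem_head? hE)) hEA hAB)
      exact hEA (hcon E (List.mem_cons_of_mem _ hE))

/-- An ascent-free word of invariant sets of nonnegative integers whose first letter contains `0`.
-/
structure IsWord (n m : ℕ) (w : List (Set ℤ)) : Prop where
  inv : ∀ A ∈ w, IsInvariant n m A
  nonneg : ∀ A ∈ w, ∀ x ∈ A, 0 ≤ x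
  chain : w.IsChain fun A B => ¬ Below n m A B
  zero_mem : ∀ A ∈ w.head?, (0 : ℤ) ∈ A

theorem IsWord.exists_builds (hn : 0 < n) (hmn : Nat.Coprime m n) {w : List (Set ℤ)}
    (h : IsWord n m w) : ∃ D, Builds n m w.reverse D := by
  induction w using List.reverseRecOn with
  | nil => exact ⟨[], .nil⟩
  | append_singleton w A ih =>
    obtain ⟨hw, -, hlast⟩ := List.isChain_append.1 h.chain
    have hA := h.inv A (by simp)
    have hposA := h.nonneg A (by simp)
    obtain ⟨D', hD'⟩ := ih ⟨fun B hB => h.inv B (by simp [hB]),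
      fun B hB => h.nonneg B (by simp [hB]), hw,
      fun B hB => h.zero_mem B (by rw [List.head?_append]; simp [Option.mem_def.1 hB])⟩
    have hhead : ∀ B ∈ w.reverse.head?, ¬ Below n m B A := fun B hB =>
      hlast B (by simpa using hB) A (by simp)
    obtain ⟨D, hD⟩ : ∃ D, Splice n m A D' D := by
      refine exists_splice hA ?_
      rcases eq_or_ne w [] with rfl | hne
      · refine ⟨[], List.nil_prefix, by simpa using h.zero_mem A (by simp), fun hmem => ?_⟩
        have := hposA _ hmem
        simp at this
        omega
      · obtain ⟨B, hB, hBA⟩ := hD'.exists_common_vertex hn hmn (by simpa using hne) hA hposA hhead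
        obtain ⟨x, hxB, hxA⟩ := Set.not_disjoint_iff.1 hBA
        obtain ⟨p, hp, rfl⟩ := hD'.exists_prefix hn hmn hB hxB
        exact ⟨p, hp, hxA⟩
    rw [List.reverse_append]
    exact ⟨D, .cons hD' hA hposA hhead hD⟩

theorem Builds.isWord {v : List (Set ℤ)} {D : List LatticeStep} (h : Builds n m v D) :
    IsWord n m v.reverse := by
  induction h with
  | nil => exact ⟨by simp, by simp, by simp, by simp⟩
  | @cons A v D₁ D hv hA hpos hhead hs ih =>
    refine ⟨?_, ?_, ?_, ?_⟩
    · intro B hB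
      exact (Builds.cons hv hA hpos hhead hs).inv B (List.mem_reverse.1 hB)
    · intro B hB
      exact (Builds.cons hv hA hpos hhead hs).nonneg B (List.mem_reverse.1 hB)
    · rw [List.reverse_cons]
      refine ih.chain.append (by simp) fun B hB C hC => ?_
      obtain rfl : A = C := by simpa using hC
      exact hhead B (by simpa using hB)
    · intro B hB
      rcases eq_or_ne v [] with rfl | hne
      · obtain rfl : A = B := by simpa using hB
        cases hv
        obtain ⟨α, l, β, h, -, hl, -⟩ := hs
        obtain ⟨rfl, rfl⟩ := List.append_eq_nil_iff.1 h.symm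
        exact hl.start_mem.1
      · refine ih.zero_mem B ?_
        rw [List.reverse_cons, List.head?_append_of_ne_nil _ (by simpa using hne)] at hB
        exact hB

/-- Every closed walk with nonnegative heights is built by some word. -/
theorem exists_builds_of_nonneg (hn : 0 < n) (hmn : Nat.Coprime m n) {D : List LatticeStep}
    (h0 : height n m D = 0) (hpos : ∀ p, p <+: D → 0 ≤ height n m p) : ∃ v, Builds n m v D := by
  induction hk : D.length using Nat.strong_induction_on generalizing D with
  | _ k ih =>
    subst hk
    rcases eq_or_ne D [] with rfl | hD
    · exact ⟨[], .nil⟩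
    have hsplice : ∀ A D', IsInvariant n m A → Splice n m A D' D → (∀ x ∈ A, 0 ≤ x) ∧
        D'.length < D.length ∧ height n m D' = 0 ∧ ∀ p, p <+: D' → 0 ≤ height n m p := by
      intro A D' hA hs
      refine ⟨fun y hy => ?_, ?_, ?_, fun p hp => ?_⟩
      · obtain ⟨x, hx, t, rfl⟩ := (mem_iff_exists_rim hn hA).1 hy
        obtain ⟨p, hp, rfl⟩ := (hs.exists_prefix_right hn hmn hA).2 (Or.inr hx)
        have := hpos p hp
        positivity
      · obtain ⟨h1, h2⟩ := hs.counts hn hA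
        rw [length_eq_count, length_eq_count D, h1, h2]
        omega
      · obtain ⟨h1, h2⟩ := hs.counts hn hA
        rw [height_eq_count, h1, h2] at h0
        rw [height_eq_count]
        push_cast at h0
        linear_combination h0
      · obtain ⟨q, hq, h⟩ := (hs.exists_prefix_right hn hmn hA).2 (Or.inl ⟨p, hp, rfl⟩)
        exact h ▸ hpos q hq
    -- among the removable loops, choose one with the smallest minimum: nothing lies below it
    obtain ⟨A, ⟨hA, D', hs⟩, hmin⟩ := WellFounded.has_min
      (InvImage.wf (fun A : Set ℤ => sInf {k : ℕ | (k : ℤ) ∈ A}) Nat.lt_wfRel.wf)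
      {A | IsInvariant n m A ∧ ∃ D', Splice n m A D' D} (by
        obtain ⟨A, D', hA, hs⟩ := exists_splice_of_closed hn hmn hD h0
        exact ⟨A, hA, D', hs⟩)
    obtain ⟨hposA, hlen, h0', hpos'⟩ := hsplice A D' hA hs
    obtain ⟨v, hv⟩ := ih _ hlen h0' hpos' rfl
    refine ⟨A :: v, .cons hv hA hposA (fun B hB hBA => ?_) hs⟩
    cases hv with
    | nil => simp at hB
    | @cons C v D₀ _ hv hC _ _ hs' =>
      obtain rfl : C = B := by simpa using hB
      have hdis : Disjoint (rim n m A) (rim n m C) :=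
        Set.disjoint_left.2 fun x hxA hxC => hxC.2 (hBA x hxA.1)
      obtain ⟨D₁, hD₁⟩ := hs'.commute hn hA hdis hs
      refine hmin C ⟨hC, D₁, hD₁⟩ ?_
      have hposC := (hsplice C D₁ hC hD₁).1
      have hne : {k : ℕ | (k : ℤ) ∈ A}.Nonempty := by
        obtain ⟨x, hx⟩ := hA.nonempty
        exact ⟨x.toNat, by simpa [Int.toNat_of_nonneg (hposA x hx)] using hx⟩
      have h1 := hBA _ (Nat.sInf_mem hne)
      have h2 := hposC _ h1
      have h3 : sInf {k : ℕ | (k : ℤ) ∈ C} ≤ sInf {k : ℕ | (k : ℤ) ∈ A} - (n + m) := by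
        refine Nat.sInf_le ?_
        change (((_ - _ : ℕ) : ℤ)) ∈ C
        convert h1 using 1
        omega
      change sInf {k : ℕ | (k : ℤ) ∈ C} < sInf {k : ℕ | (k : ℤ) ∈ A}
      omega

open Classical in
/-- The step word of the Dyck path built by a word of invariant sets; the empty list, as a junk
value, if the list builds no walk. -/
noncomputable def pathWord (n m : ℕ) (w : List (Set ℤ)) : List LatticeStep :=
  if h : ∃ D, Builds n m w.reverse D then h.choose else []

theorem IsWord.builds_pathWord (hn : 0 < n) (hmn : Nat.Coprime m n) {w : List (Set ℤ)}
    (h : IsWord n m w) : Builds n m w.reverse (pathWord n m w) := by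
  have := h.exists_builds hn hmn
  rw [pathWord, dif_pos this]
  exact this.choose_spec

theorem pathWord_injOn (hn : 0 < n) (hmn : Nat.Coprime m n) :
    Set.InjOn (pathWord n m) {w | IsWord n m w} := by
  intro w hw w' hw' h
  have h1 := hw.builds_pathWord hn hmn
  rw [h] at h1
  exact List.reverse_injective (h1.injective hn hmn (hw'.builds_pathWord hn hmn))

/-- The Dyck path built by a word of invariant sets. -/
noncomputable def IsWord.toDyckPath (hn : 0 < n) (hmn : Nat.Coprime m n) {w : List (Set ℤ)}
    (h : IsWord n m w) : RatDyckPath (w.length * n) (w.length * m) where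
  steps := pathWord n m w
  count_V := by simpa using ((h.builds_pathWord hn hmn).counts hn).1
  count_H := by simpa using ((h.builds_pathWord hn hmn).counts hn).2
  below p hp := by
    have h1 := (h.builds_pathWord hn hmn).height_nonneg hn hmn hp
    rw [height_eq_count] at h1
    have h2 : p.count .H * n ≤ p.count .V * m := by zify; linarith
    calc p.count .H * (w.length * n) = w.length * (p.count .H * n) := by ring
      _ ≤ w.length * (p.count .V * m) := Nat.mul_le_mul_left _ h2
      _ = p.count .V * (w.length * m) := by ring

theorem exists_isWord_pathWord_eq (hn : 0 < n) (hmn : Nat.Coprime m n) {k : ℕ}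
    (P : RatDyckPath (k * n) (k * m)) :
    ∃ w, IsWord n m w ∧ w.length = k ∧ pathWord n m w = P.steps := by
  have hP0 : height n m P.steps = 0 := by
    rw [height_eq_count, P.count_V, P.count_H]; push_cast; ring
  obtain ⟨v, hv⟩ := exists_builds_of_nonneg hn hmn hP0 fun p hp => by
    rcases Nat.eq_zero_or_pos k with rfl | hk
    · have : P.steps = [] := by
        rw [← List.length_eq_zero_iff, length_eq_count, P.count_V, P.count_H]; simp
      rw [this] at hp
      rw [List.prefix_nil.1 hp]; simp
    · have h1 := P.below p hp
      have h2 : k * (p.count .H * n) ≤ k * (p.count .V * m) := by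
        calc k * (p.count .H * n) = p.count .H * (k * n) := by ring
          _ ≤ p.count .V * (k * m) := h1
          _ = k * (p.count .V * m) := by ring
      have h3 := Nat.le_of_mul_le_mul_left h2 hk
      rw [height_eq_count]
      zify at h3
      linarith
  refine ⟨v.reverse, hv.isWord, ?_, ?_⟩
  · have h1 := (hv.counts hn).1
    rw [P.count_V] at h1
    rw [List.length_reverse]
    exact (Nat.eq_of_mul_eq_mul_right hn h1).symm
  · have := hv.isWord.builds_pathWord hn hmn
    rw [List.reverse_reverse] at this
    exact this.functional hv

/-! ### Cutting a sequence of invariant sets into words -/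

/-- The translate `A + c`. -/
def translate (c : ℤ) (A : Set ℤ) : Set ℤ := {x | x - c ∈ A}

theorem mem_translate {c x : ℤ} : x ∈ translate c A ↔ x - c ∈ A := Iff.rfl

theorem translate_translate (c c' : ℤ) (A : Set ℤ) :
    translate c (translate c' A) = translate (c + c') A := by
  ext x; simp [translate, sub_sub]

@[simp] theorem translate_zero (A : Set ℤ) : translate 0 A = A := by
  ext x; simp [translate]

theorem translate_injective (c : ℤ) : Function.Injective (translate c) := by
  intro A B h
  simpa [translate_translate] using congrArg (translate (-c)) h

theorem isInvariant_translate {c : ℤ} (hA : IsInvariant n m A) :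
    IsInvariant n m (translate c A) where
  nonempty := by
    obtain ⟨x, hx⟩ := hA.nonempty
    exact ⟨x + c, by simpa [mem_translate] using hx⟩
  bddBelow := by
    obtain ⟨b, hb⟩ := hA.bddBelow
    exact ⟨b + c, fun x hx => by have := hb hx; linarith⟩
  add_left x hx := by
    have := hA.add_left _ hx
    rw [mem_translate]; convert this using 1; ring
  add_right x hx := by
    have := hA.add_right _ hx
    rw [mem_translate]; convert this using 1; ring

theorem below_translate {c : ℤ} : Below n m (translate c A) (translate c B) ↔ Below n m A B := by
  constructor
  · intro h y hy
    have := h (y + c) (by simpa [mem_translate] using hy)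
    rw [mem_translate] at this
    convert this using 1; ring
  · intro h y hy
    have := h _ hy
    rw [mem_translate]
    convert this using 1; ring

/-- The concatenation of a list of words, the `j`-th of which (counted from `0`) is translated by
`-j`. -/
def assemble : List (List (Set ℤ)) → List (Set ℤ)
  | [] => []
  | b :: bs => b ++ (assemble bs).map (translate (-1))

/-- The sequences which `assemble` produces from `t` words: ascent-free, starting at level `0` or
below, and staying at levels `≥ 1 - t`. -/
structure IsDescending (n m t : ℕ) (w : List (Set ℤ)) : Prop where
  inv : ∀ A ∈ w, IsInvariant n m A
  bound : ∀ A ∈ w, ∀ x ∈ A, 1 ≤ x + t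
  chain : w.IsChain fun A B => ¬ Below n m A B
  head : ∀ A ∈ w.head?, ∃ x ∈ A, x ≤ 0

theorem isDescending_assemble {bs : List (List (Set ℤ))} (h : ∀ b ∈ bs, IsWord n m b) :
    IsDescending n m bs.length (assemble bs) := by
  induction bs with
  | nil => exact ⟨by simp [assemble], by simp [assemble], by simp [assemble], by simp [assemble]⟩
  | cons b bs ih =>
    have hb := h b (by simp)
    have hbs := ih fun b' hb' => h b' (by simp [hb'])
    refine ⟨fun A hA => ?_, fun A hA x hx => ?_, ?_, fun A hA => ?_⟩
    · rcases List.mem_append.1 hA with hA | hA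
      · exact hb.inv A hA
      · obtain ⟨B, hB, rfl⟩ := List.mem_map.1 hA
        exact isInvariant_translate (hbs.inv B hB)
    · rw [List.length_cons]
      push_cast
      rcases List.mem_append.1 hA with hA | hA
      · have := hb.nonneg A hA x hx
        omega
      · obtain ⟨B, hB, rfl⟩ := List.mem_map.1 hA
        have := hbs.bound B hB _ hx
        omega
    · refine hb.chain.append ?_ fun A hA B hB hAB => ?_
      · rw [List.isChain_map]
        simpa only [below_translate] using hbs.chain
      · -- the next word starts below level `0`, whereas `A` consists of natural numbers
        rw [List.head?_map] at hB
        obtain ⟨E, hE, rfl⟩ := Option.mem_map.1 hB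
        obtain ⟨x, hx, hx0⟩ := hbs.head E hE
        have := hb.nonneg A (List.mem_of_mem_getLast? hA) _
          (hAB (x - 1) (by simpa [mem_translate] using hx))
        omega
    · rcases b with _ | ⟨B, b⟩
      · simp only [assemble, List.nil_append, List.head?_map] at hA
        obtain ⟨E, hE, rfl⟩ := Option.mem_map.1 hA
        obtain ⟨x, hx, hx0⟩ := hbs.head E hE
        exact ⟨x - 1, by simpa [mem_translate] using hx, by omega⟩
      · obtain rfl : B = A := by simpa [assemble] using hA
        exact ⟨0, hb.zero_mem B (by simp), le_rfl⟩

theorem append_unique_of_forall {α : Type*} {p : α → Prop} {a b a' b' : List α}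
    (h : a ++ b = a' ++ b') (ha : ∀ x ∈ a, p x) (ha' : ∀ x ∈ a', p x)
    (hb : ∀ x ∈ b.head?, ¬ p x) (hb' : ∀ x ∈ b'.head?, ¬ p x) : a = a' ∧ b = b' := by
  induction a generalizing a' with
  | nil =>
    rcases a' with _ | ⟨y, a'⟩
    · exact ⟨rfl, h⟩
    · simp only [List.nil_append] at h
      subst h
      exact absurd (ha' y (by simp)) (hb y (by simp))
  | cons x a ih =>
    rcases a' with _ | ⟨y, a'⟩
    · simp only [List.nil_append] at h
      subst h
      exact absurd (ha x (by simp)) (hb' x (by simp))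
    · simp only [List.cons_append, List.cons.injEq] at h
      obtain ⟨rfl, h⟩ := h
      obtain ⟨rfl, rfl⟩ := ih h (fun z hz => ha z (by simp [hz])) fun z hz => ha' z (by simp [hz])
      exact ⟨rfl, rfl⟩

theorem exists_append_of_forall {α : Type*} (p : α → Prop) (l : List α) :
    ∃ a b, l = a ++ b ∧ (∀ x ∈ a, p x) ∧ ∀ x ∈ b.head?, ¬ p x := by
  induction l with
  | nil => exact ⟨[], [], rfl, by simp, by simp⟩
  | cons x l ih =>
    by_cases hx : p x
    · obtain ⟨a, b, rfl, ha, hb⟩ := ih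
      exact ⟨x :: a, b, rfl, by simpa using ⟨hx, ha⟩, hb⟩
    · exact ⟨[], x :: l, rfl, by simp, by simpa using hx⟩

theorem assemble_injective {bs bs' : List (List (Set ℤ))} (hlen : bs.length = bs'.length)
    (h : ∀ b ∈ bs, IsWord n m b) (h' : ∀ b ∈ bs', IsWord n m b)
    (he : assemble bs = assemble bs') : bs = bs' := by
  induction bs generalizing bs' with
  | nil => simpa [eq_comm] using hlen
  | cons b bs ih =>
    rcases bs' with _ | ⟨b', bs'⟩
    · simp at hlen
    have hneg : ∀ {cs : List (List (Set ℤ))}, (∀ c ∈ cs, IsWord n m c) →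
        ∀ A ∈ ((assemble cs).map (translate (-1))).head?, ¬ ∀ x ∈ A, 0 ≤ x := by
      intro cs hcs A hA hpos
      rw [List.head?_map] at hA
      obtain ⟨E, hE, rfl⟩ := Option.mem_map.1 hA
      obtain ⟨x, hx, hx0⟩ := (isDescending_assemble hcs).head E hE
      have := hpos (x - 1) (by simpa [mem_translate] using hx)
      omega
    have hbs : ∀ c ∈ bs, IsWord n m c := fun c hc => h c (by simp [hc])
    have hbs' : ∀ c ∈ bs', IsWord n m c := fun c hc => h' c (by simp [hc])
    obtain ⟨rfl, h2⟩ := append_unique_of_forall (p := fun A : Set ℤ => ∀ x ∈ A, 0 ≤ x) he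
      (h b (by simp)).nonneg (h' b' (by simp)).nonneg (hneg hbs) (hneg hbs')
    rw [ih (by simpa using hlen) hbs hbs' ((translate_injective (-1)).list_map h2)]

theorem exists_assemble_eq {t : ℕ} {w : List (Set ℤ)} (hw : IsDescending n m t w) :
    ∃ bs : List (List (Set ℤ)), bs.length = t ∧ (∀ b ∈ bs, IsWord n m b) ∧ assemble bs = w := by
  induction t generalizing w with
  | zero =>
    refine ⟨[], rfl, by simp, ?_⟩
    rcases w with _ | ⟨A, w⟩
    · rfl
    · obtain ⟨x, hx, hx0⟩ := hw.head A (by simp)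
      have := hw.bound A (by simp) x hx
      push_cast at this
      omega
  | succ t ih =>
    obtain ⟨b, r, rfl, hb, hr⟩ := exists_append_of_forall (fun A : Set ℤ => ∀ x ∈ A, 0 ≤ x) w
    obtain ⟨hcb, hcr, -⟩ := List.isChain_append.1 hw.chain
    obtain ⟨bs, hlen, hbs, he⟩ := ih (w := r.map (translate 1)) (by
      refine ⟨fun A hA => ?_, fun A hA x hx => ?_, ?_, fun A hA => ?_⟩
      · obtain ⟨B, hB, rfl⟩ := List.mem_map.1 hA
        exact isInvariant_translate (hw.inv B (by simp [hB]))
      · obtain ⟨B, hB, rfl⟩ := List.mem_map.1 hA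
        have := hw.bound B (by simp [hB]) _ hx
        push_cast at this
        omega
      · rw [List.isChain_map]
        simpa only [below_translate] using hcr
      · rw [List.head?_map] at hA
        obtain ⟨B, hB, rfl⟩ := Option.mem_map.1 hA
        have := hr B hB
        push Not at this
        obtain ⟨x, hx, hx0⟩ := this
        exact ⟨x + 1, by simpa [mem_translate] using hx, by omega⟩)
    refine ⟨b :: bs, by simp [hlen], ?_, ?_⟩
    · intro c hc
      rcases List.mem_cons.1 hc with rfl | hc
      · refine ⟨fun A hA => hw.inv A (by simp [hA]), hb, hcb, fun A hA => ?_⟩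
        obtain ⟨x, hx, hx0⟩ := hw.head A (by rw [List.head?_append]; simp [Option.mem_def.1 hA])
        have := hb A (List.mem_of_mem_head? hA) x hx
        rwa [le_antisymm hx0 this] at hx
      · exact hbs c hc
    · simp [assemble, he, translate_translate, Function.comp_def]

theorem length_assemble (bs : List (List (Set ℤ))) :
    (assemble bs).length = (bs.map List.length).sum := by
  induction bs with
  | nil => rfl
  | cons b bs ih => simp [assemble, ih]

/-! ### The pattern of a sequence of words -/

/-- The lattice word `V ^ u₀ H V ^ u₁ H ⋯ H V ^ uₛ`. -/
def patternSteps (us : List ℕ) : List LatticeStep :=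
  [LatticeStep.H].intercalate (us.map fun u => List.replicate u .V)

theorem patternSteps_singleton (u : ℕ) : patternSteps [u] = List.replicate u .V := by
  simp [patternSteps]

theorem patternSteps_cons {u : ℕ} {us : List ℕ} (h : us ≠ []) :
    patternSteps (u :: us) = List.replicate u .V ++ (.H :: patternSteps us) := by
  simp [patternSteps, List.intercalate_cons_of_ne_nil, h]

theorem splitOn_patternSteps {us : List ℕ} (h : us ≠ []) :
    ((patternSteps us).splitOn .H).map List.length = us := by
  rw [patternSteps, List.splitOn_intercalate]
  · simp [Function.comp_def]
  · simp
  · simpa using h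

theorem not_mem_of_mem_splitOn {l : List LatticeStep} :
    ∀ b ∈ l.splitOn .H, LatticeStep.H ∉ b := by
  induction l with
  | nil => simp
  | cons a l ih =>
    rw [List.splitOn_cons_eq_if_modifyHead]
    cases a
    · rcases h : l.splitOn LatticeStep.H with _ | ⟨c, cs⟩
      · simp
      · rw [h] at ih
        simpa using ih
    · simpa using ih

theorem patternSteps_splitOn (l : List LatticeStep) :
    patternSteps ((l.splitOn .H).map List.length) = l := by
  conv_rhs => rw [← List.intercalate_splitOn LatticeStep.H (xs := l)]
  rw [patternSteps, List.map_map]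
  congr 1
  conv_rhs => rw [← List.map_id (l.splitOn LatticeStep.H)]
  refine List.map_congr_left fun b hb => ?_
  have := not_mem_of_mem_splitOn b hb
  symm
  rw [Function.comp_apply, id, List.eq_replicate_iff]
  refine ⟨rfl, fun a ha => ?_⟩
  cases a
  · rfl
  · exact absurd ha this

theorem count_patternSteps {us : List ℕ} (h : us ≠ []) :
    (patternSteps us).count .V = us.sum ∧ (patternSteps us).count .H + 1 = us.length := by
  induction us with
  | nil => exact absurd rfl h
  | cons u us ih =>
    rcases eq_or_ne us [] with rfl | hus
    · simp [patternSteps_singleton, List.count_replicate]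
    · obtain ⟨h1, h2⟩ := ih hus
      rw [patternSteps_cons hus]
      simp [List.count_replicate, h1, ← h2]

theorem prefix_replicate_append_cons {α : Type*} {a b : α} {u : ℕ} {l p : List α}
    (h : p <+: List.replicate u a ++ b :: l) :
    (∃ c ≤ u, p = List.replicate c a) ∨ ∃ q, q <+: l ∧ p = List.replicate u a ++ b :: q := by
  rcases prefix_append_cases h with ⟨hp, -⟩ | ⟨q, hq, rfl⟩
  · have := List.prefix_replicate_iff.1 hp
    exact Or.inl ⟨_, this.1, this.2⟩
  · rcases q with _ | ⟨c, q⟩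
    · exact Or.inl ⟨u, le_rfl, by simp⟩
    · obtain ⟨rfl, hq'⟩ := List.cons_prefix_cons.1 hq
      exact Or.inr ⟨q, hq', rfl⟩

/-- The pattern of a list of words stays below the diagonal exactly when every element `x` of the
`i`-th set of the assembled sequence satisfies `0 ≤ d * x + i * s`: this is the case `i₀ = j₀ = 0`.
The offsets count the vertical and horizontal steps already made, so that the induction can peel
off one word at a time. -/
theorem below_diagonal_iff {d s : ℕ} {i₀ j₀ : ℕ} {bs : List (List (Set ℤ))} (hbs : bs ≠ [])
    (h : ∀ b ∈ bs, IsWord n m b) (hj : j₀ + bs.length = s + 1)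
    (hi : i₀ + (bs.map List.length).sum = d) :
    (∀ p, p <+: patternSteps (bs.map List.length) →
      (j₀ + p.count .H) * d ≤ (i₀ + p.count .V) * s) ↔
    ∀ i : ℕ, ∀ A ∈ (assemble bs)[i]?, ∀ x ∈ A, (0 : ℤ) ≤ d * (x - j₀) + (i₀ + i) * s := by
  induction bs generalizing i₀ j₀ with
  | nil => exact absurd rfl hbs
  | cons b bs ih =>
    have hb := h b (by simp)
    have hrest : (∀ i : ℕ, ∀ A ∈ (assemble (b :: bs))[i]?, ∀ x ∈ A,
          (0 : ℤ) ≤ d * (x - j₀) + (i₀ + i) * s) ↔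
        (b ≠ [] → j₀ * d ≤ i₀ * s) ∧ ∀ i : ℕ, ∀ A ∈ (assemble bs)[i]?, ∀ x ∈ A,
          (0 : ℤ) ≤ d * (x - (j₀ + 1 : ℕ)) + ((i₀ + b.length : ℕ) + i) * s := by
      constructor
      · intro hA
        refine ⟨fun hne => ?_, fun i A hAi x hx => ?_⟩
        · rcases b with _ | ⟨B, b⟩
          · exact absurd rfl hne
          · have := hA 0 B (by simp [assemble]) 0 (hb.zero_mem B (by simp))
            zify
            push_cast at this
            linarith
        · have := hA (b.length + i) (translate (-1) A) (by
            rw [assemble, List.getElem?_append_right (by omega), Nat.add_sub_cancel_left,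
              List.getElem?_map]
            exact Option.mem_map_of_mem _ hAi) (x - 1) (by simpa [mem_translate] using hx)
          push_cast at this ⊢
          linarith
      · rintro ⟨h1, h2⟩ i A hAi x hx
        rcases lt_or_ge i b.length with hlt | hge
        · rw [assemble, List.getElem?_append_left hlt] at hAi
          have hAb := List.mem_of_getElem? (Option.mem_def.1 hAi)
          have h3 := hb.nonneg A hAb x hx
          have h4 := h1 (List.ne_nil_of_mem hAb)
          zify at h4
          have h5 : (0 : ℤ) ≤ d * x := by positivity
          have h6 : (0 : ℤ) ≤ i * s := by positivity
          linarith
        · rw [assemble, List.getElem?_append_right hge, List.getElem?_map] at hAi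
          obtain ⟨B, hB, rfl⟩ := Option.mem_map.1 hAi
          have := h2 _ B hB _ hx
          push_cast [hge] at this
          linarith
    rw [hrest]
    rcases eq_or_ne bs [] with rfl | hne
    · simp only [List.length_cons, List.length_nil, List.map_cons, List.map_nil, List.sum_cons,
        List.sum_nil] at hj hi
      obtain rfl : j₀ = s := by omega
      simp only [List.map_cons, List.map_nil, patternSteps_singleton]
      constructor
      · intro hp
        refine ⟨fun _ => by simpa using hp [] List.nil_prefix, by simp [assemble]⟩
      · rintro ⟨h1, -⟩ p hp
        obtain ⟨c, hc⟩ : ∃ c, p = List.replicate c .V :=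
          ⟨_, (List.prefix_replicate_iff.1 hp).2⟩
        subst hc
        have h2 : j₀ * d ≤ i₀ * j₀ := by
          rcases eq_or_ne b [] with rfl | hbne
          · simp at hi; rw [hi, mul_comm]
          · exact h1 hbne
        simp [List.count_replicate]
        nlinarith
    · have ih' := ih (i₀ := i₀ + b.length) (j₀ := j₀ + 1) hne (fun c hc => h c (by simp [hc]))
        (by simp only [List.length_cons] at hj; omega)
        (by simp only [List.map_cons, List.sum_cons] at hi; omega)
      rw [← ih', List.map_cons, patternSteps_cons (by simpa using hne)]
      constructor
      · intro hp
        refine ⟨fun _ => by simpa using hp [] List.nil_prefix, fun q hq => ?_⟩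
        have := hp (List.replicate b.length .V ++ .H :: q)
          ((List.prefix_append_right_inj _).2 (List.cons_prefix_cons.2 ⟨rfl, hq⟩))
        simp [List.count_replicate] at this
        linarith
      · rintro ⟨h1, h2⟩ p hp
        rcases prefix_replicate_append_cons hp with ⟨c, -, rfl⟩ | ⟨q, hq, rfl⟩
        · have h3 : j₀ * d ≤ i₀ * s := by
            rcases eq_or_ne b [] with rfl | hbne
            · have := h2 [] List.nil_prefix
              simp at this
              nlinarith
            · exact h1 hbne
          simp [List.count_replicate]
          nlinarith
        · have := h2 q hq
          simp [List.count_replicate]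
          linarith

/-! ### Residue slices -/

/-- The elements of `Δ` congruent to `i * s` modulo `d`, rescaled to a set of integers. -/
def slice (d s : ℕ) (Δ : Set ℤ) (i : ℕ) : Set ℤ := {x | d * x + i * s ∈ Δ}

/-- The slices of `Δ` for the residues `0, s, ..., (d - 1) * s`. -/
def slices (d s : ℕ) (Δ : Set ℤ) : List (Set ℤ) := (List.range d).map (slice d s Δ)

theorem mem_slice {i : ℕ} {x : ℤ} : x ∈ slice d s Δ i ↔ (d * x + i * s : ℤ) ∈ Δ := Iff.rfl

@[simp] theorem length_slices : (slices d s Δ).length = d := by simp [slices]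

theorem mem_getElem?_slices {i : ℕ} : A ∈ (slices d s Δ)[i]? ↔ i < d ∧ A = slice d s Δ i := by
  rw [slices, List.getElem?_map, Option.mem_map]
  constructor
  · rintro ⟨j, hj, rfl⟩
    obtain ⟨hi, rfl⟩ := List.getElem?_eq_some_iff.1 (Option.mem_def.1 hj)
    simpa using hi
  · rintro ⟨hi, rfl⟩
    exact ⟨i, by simp [hi], rfl⟩

theorem exists_eq_mul_add_mul (hd : 0 < d) (hds : Nat.Coprime d s) (z : ℤ) :
    ∃ i < d, ∃ x : ℤ, z = d * x + i * s := by
  obtain ⟨i, hi, x, hx⟩ := exists_mul_modEq hd hds.symm z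
  exact ⟨i, hi, x, by linarith⟩

theorem eq_of_mul_add_mul_eq (hd : 0 < d) (hds : Nat.Coprime d s) {i j : ℕ} (hi : i < d)
    (hj : j < d) {x y : ℤ} (h : (d * x + i * s : ℤ) = d * y + j * s) : i = j ∧ x = y := by
  have h1 : (d : ℤ) ∣ (i - j) * s := ⟨y - x, by linear_combination h⟩
  have h2 : (d : ℤ) ∣ i - j :=
    (Nat.isCoprime_iff_coprime.2 hds).dvd_of_dvd_mul_right h1
  have h3 : (i : ℤ) - j = 0 := Int.eq_zero_of_abs_lt_dvd h2 (by rw [abs_lt]; constructor <;> omega)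
  have h4 : i = j := by omega
  subst h4
  have : (d : ℤ) * x = d * y := by linarith
  exact ⟨rfl, mul_left_cancel₀ (by exact_mod_cast hd.ne') this⟩

theorem slices_injective (hd : 0 < d) (hds : Nat.Coprime d s) :
    Function.Injective (slices d s) := by
  intro Δ Δ' h
  ext z
  obtain ⟨i, hi, x, rfl⟩ := exists_eq_mul_add_mul hd hds z
  have h1 : slice d s Δ i ∈ (slices d s Δ)[i]? := mem_getElem?_slices.2 ⟨hi, rfl⟩
  rw [h, mem_getElem?_slices] at h1
  rw [← mem_slice, h1.2, mem_slice]

theorem exists_slices_eq (hd : 0 < d) (hds : Nat.Coprime d s) {w : List (Set ℤ)}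
    (hw : w.length = d) : ∃ Δ, slices d s Δ = w := by
  refine ⟨{z | ∃ i : ℕ, ∃ A ∈ w[i]?, ∃ x ∈ A, z = d * x + i * s}, ?_⟩
  refine List.ext_getElem (by simp [hw]) fun i h1 h2 => ?_
  simp only [slices, List.getElem_map, List.getElem_range]
  ext x
  rw [mem_slice]
  constructor
  · rintro ⟨j, A, hA, y, hy, h⟩
    obtain ⟨hj, rfl⟩ := List.getElem?_eq_some_iff.1 (Option.mem_def.1 hA)
    obtain ⟨rfl, rfl⟩ := eq_of_mul_add_mul_eq hd hds (by omega) (by omega) h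
    exact hy
  · intro hx
    exact ⟨i, w[i], by simp, x, hx, rfl⟩

/-- Being suspicious at the residue of `i * s` is a relation between two consecutive slices. -/
theorem isSuspiciousAt_iff (hn : 0 < n) (hmn : Nat.Coprime m n) {i : ℕ} {j : ℤ}
    (hj : (d : ℤ) ∣ j - i * s) (hA : IsInvariant n m (slice d s Δ i))
    (hB : ∀ x ∈ slice d s Δ (i + 1), x + n ∈ slice d s Δ (i + 1)) :
    IsSuspiciousAt n m d Δ s j ↔ Below n m (slice d s Δ i) (slice d s Δ (i + 1)) := by
  rw [below_iff_forall_generator hn hmn hA hB]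
  have hstep : ∀ x : ℤ, (d * x + i * s + (m * d : ℤ) + s ∈ Δ) ↔ x + m ∈ slice d s Δ (i + 1) := by
    intro x
    rw [mem_slice]
    refine iff_of_eq (congrArg (· ∈ Δ) ?_)
    push_cast; ring
  have hgen : ∀ x : ℤ, IsGeneratorOf (n * d) Δ (d * x + i * s) ↔
      x ∈ slice d s Δ i ∧ x - n ∉ slice d s Δ i := by
    intro x
    refine and_congr Iff.rfl (not_congr ?_)
    rw [mem_slice]
    refine iff_of_eq (congrArg (· ∈ Δ) ?_)
    push_cast; ring
  constructor
  · intro h x hx hx'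
    rw [← hstep]
    refine h _ ((hgen x).2 ⟨hx, hx'⟩) ?_
    rw [Int.modEq_iff_dvd]
    have := hj.sub (Dvd.intro x rfl)
    rwa [sub_sub, add_comm ((i : ℤ) * s)] at this
  · intro h a ha haj
    obtain ⟨y, hy⟩ := hj
    obtain ⟨z, hz⟩ := Int.modEq_iff_dvd.1 haj
    obtain rfl : a = d * (y - z) + i * s := by linear_combination hy - hz
    rw [hstep]
    exact h _ ((hgen _).1 ha).1 ((hgen _).1 ha).2

theorem IsInvariant.exists_forall_ge_mem (hn : 0 < n) (hmn : Nat.Coprime m n)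
    (hA : IsInvariant n m A) : ∃ c, ∀ x, c ≤ x → x ∈ A := by
  obtain ⟨a, ha⟩ := hA.nonempty
  refine ⟨a + n * m, fun x hx => ?_⟩
  obtain ⟨t, ht, k, hk⟩ := exists_mul_modEq hn hmn (x - a)
  have h1 : (t : ℤ) * m ≤ n * m := by exact_mod_cast Nat.mul_le_mul_right m ht.le
  have h2 : 0 ≤ k := by
    by_contra hneg
    have : (0 : ℤ) < n := by exact_mod_cast hn
    nlinarith
  have := hA.add_left_mul (hA.add_right_mul ha t) k.toNat
  rw [Int.toNat_of_nonneg h2] at this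
  convert this using 1
  linear_combination hk

theorem isInvariant_slice (hd : 0 < d) (h : IsInvariantSubset n m d Δ) (i : ℕ) :
    IsInvariant n m (slice d s Δ i) where
  nonempty := by
    by_contra hemp
    rw [Set.not_nonempty_iff_eq_empty, Set.eq_empty_iff_forall_notMem] at hemp
    have hinj : Function.Injective fun k : ℕ => (d * k + i * s : ℤ) := by
      intro k k' hk
      simpa [hd.ne'] using hk
    exact Set.infinite_of_injective_forall_mem hinj
      (s := {x : ℤ | 0 ≤ x ∧ x ∉ Δ}) (fun k => ⟨by positivity, hemp k⟩) h.cofinite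
  bddBelow := by
    refine ⟨-(i * s : ℤ), fun x hx => ?_⟩
    have h1 := h.nonneg _ hx
    have h2 : (1 : ℤ) ≤ d := by exact_mod_cast hd
    have h3 : (0 : ℤ) ≤ i * s := by positivity
    by_contra hlt
    nlinarith
  add_left x hx := by
    have := h.add_dn_mem _ hx
    rw [mem_slice]
    convert this using 1; ring
  add_right x hx := by
    have := h.add_dm_mem _ hx
    rw [mem_slice]
    convert this using 1; ring

theorem admissible_iff_slices (hn : 0 < n) (hmn : Nat.Coprime m n) (hd : 0 < d)
    (hds : Nat.Coprime d s) :
    IsInvariantSubset n m d Δ ∧ IsSAdmissible n m d s Δ ↔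
      IsDescending n m (s + 1) (slices d s Δ) ∧
        ∀ i : ℕ, ∀ A ∈ (slices d s Δ)[i]?, ∀ x ∈ A, (0 : ℤ) ≤ d * x + i * s := by
  have hd' : (0 : ℤ) < d := by exact_mod_cast hd
  have hhead : ∀ A, A ∈ (slices d s Δ).head? ↔ A = slice d s Δ 0 := by
    intro A
    rw [List.head?_eq_getElem?, mem_getElem?_slices]
    simp [hd]
  have hmem : ∀ A, A ∈ slices d s Δ ↔ ∃ i < d, A = slice d s Δ i := by
    intro A
    simp [slices, eq_comm]
  have hchain : ((slices d s Δ).IsChain fun A B => ¬ Below n m A B) ↔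
      ∀ i, i + 1 < d → ¬ Below n m (slice d s Δ i) (slice d s Δ (i + 1)) := by
    rw [List.isChain_iff_getElem]
    simp [slices]
  constructor
  · rintro ⟨h, hadm⟩
    have hbound : ∀ i < d, ∀ x ∈ slice d s Δ i, (0 : ℤ) ≤ d * x + i * s :=
      fun i _ x hx => h.nonneg _ hx
    refine ⟨⟨?_, ?_, ?_, ?_⟩, ?_⟩
    · intro A hA
      obtain ⟨i, -, rfl⟩ := (hmem A).1 hA
      exact isInvariant_slice hd h i
    · intro A hA x hx
      obtain ⟨i, hi, rfl⟩ := (hmem A).1 hA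
      have h1 := hbound i hi x hx
      have h2 : (i : ℤ) * s ≤ d * s := by exact_mod_cast Nat.mul_le_mul_right s hi.le
      push_cast
      by_contra hlt
      nlinarith
    · rw [hchain]
      intro i hi hbel
      refine hadm ⟨(i * s : ℤ) % d, Int.emod_nonneg _ hd'.ne', Int.emod_lt_of_pos _ hd', ?_⟩
      refine (isSuspiciousAt_iff hn hmn ?_ (isInvariant_slice hd h i)
        (isInvariant_slice hd h (i + 1)).add_left).2 hbel
      exact Int.dvd_emod_sub_self
    · intro A hA
      rw [hhead] at hA
      subst hA
      exact ⟨0, by simpa [mem_slice] using h.zero_mem, le_rfl⟩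
    · intro i A hA x hx
      obtain ⟨hi, rfl⟩ := mem_getElem?_slices.1 hA
      exact hbound i hi x hx
  · rintro ⟨h, hb⟩
    have hinv : ∀ i < d, IsInvariant n m (slice d s Δ i) :=
      fun i hi => h.inv _ ((hmem _).2 ⟨i, hi, rfl⟩)
    have hbound : ∀ i < d, ∀ x ∈ slice d s Δ i, (0 : ℤ) ≤ d * x + i * s :=
      fun i hi => hb i _ (mem_getElem?_slices.2 ⟨hi, rfl⟩)
    have hnonneg : ∀ z ∈ Δ, 0 ≤ z := by
      intro z hz
      obtain ⟨i, hi, x, rfl⟩ := exists_eq_mul_add_mul hd hds z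
      exact hbound i hi x hz
    have hzero : (0 : ℤ) ∈ Δ := by
      obtain ⟨x, hx, hx0⟩ := h.head _ ((hhead _).2 rfl)
      have := hbound 0 hd x hx
      have hx0' : x = 0 := by
        refine le_antisymm hx0 ?_
        by_contra hlt
        push_cast at this
        nlinarith
      rw [hx0', mem_slice] at hx
      simpa using hx
    have hΔ : IsInvariantSubset n m d Δ := by
      refine ⟨hnonneg, hzero, ?_, ?_, ?_⟩
      · have hc : ∀ i, ∃ c, i < d → ∀ x, c ≤ x → x ∈ slice d s Δ i := by
          intro i
          by_cases hi : i < d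
          · obtain ⟨c, hc⟩ := (hinv i hi).exists_forall_ge_mem hn hmn
            exact ⟨c, fun _ => hc⟩
          · exact ⟨0, fun h => absurd h hi⟩
        choose c hc using hc
        refine ((Finset.range d).finite_toSet.biUnion fun i _ =>
          Set.finite_Icc (0 : ℤ) (d * c i + i * s)).subset ?_
        rintro z ⟨hz0, hz⟩
        obtain ⟨i, hi, x, rfl⟩ := exists_eq_mul_add_mul hd hds z
        refine Set.mem_biUnion (x := i) (by simpa using hi) ⟨hz0, ?_⟩
        have hlt : x < c i := by
          by_contra hge
          exact hz (hc i hi x (not_lt.1 hge))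
        nlinarith
      · intro z hz
        obtain ⟨i, hi, x, rfl⟩ := exists_eq_mul_add_mul hd hds z
        have := (hinv i hi).add_left x hz
        rw [mem_slice] at this
        convert this using 1; ring
      · intro z hz
        obtain ⟨i, hi, x, rfl⟩ := exists_eq_mul_add_mul hd hds z
        have := (hinv i hi).add_right x hz
        rw [mem_slice] at this
        convert this using 1; ring
    refine ⟨hΔ, ?_⟩
    rintro ⟨j, -, -, hj⟩
    obtain ⟨i, hi, hij⟩ := exists_mul_modEq hd hds.symm j
    rw [isSuspiciousAt_iff hn hmn hij (isInvariant_slice hd hΔ i)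
      (isInvariant_slice hd hΔ (i + 1)).add_left] at hj
    rcases Nat.lt_or_ge (i + 1) d with hlt | hge
    · exact hchain.1 h.chain i hlt hj
    · -- the slice after the last one is the first slice moved down by `s`, so it contains `-s`
      obtain rfl : d = i + 1 := by omega
      have h1 := hj (-s) (by
        rw [mem_slice]
        convert hzero using 1
        push_cast; ring)
      have h2 := hbound i hi _ h1
      push_cast at h2
      nlinarith

/-! ### Assembling cabled Dyck paths -/

theorem eq_of_map_length_eq_of_filter_eq {α : Type*} {bs bs' : List (List α)}
    (h : bs.map List.length = bs'.map List.length)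
    (hf : bs.filter (fun b => 0 < b.length) = bs'.filter (fun b => 0 < b.length)) : bs = bs' := by
  induction bs generalizing bs' with
  | nil => simpa [eq_comm] using h
  | cons b bs ih =>
    rcases bs' with _ | ⟨b', bs'⟩
    · simp at h
    simp only [List.map_cons, List.cons.injEq] at h
    rcases b with _ | ⟨x, b⟩
    · obtain rfl : b' = [] := List.length_eq_zero_iff.1 h.1.symm
      rw [ih h.2 (by simpa using hf)]
    · have hb' : 0 < b'.length := h.1 ▸ by simp
      rw [List.filter_cons_of_pos (by simp), List.filter_cons_of_pos (by simpa using hb'),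
        List.cons.injEq] at hf
      rw [hf.1, ih h.2 hf.2]

theorem exists_map_length_eq_filter_eq {α : Type*} (us : List ℕ) (cs : List (List α))
    (h : cs.map List.length = us.filter (fun u => 0 < u)) :
    ∃ bs : List (List α), bs.map List.length = us ∧ bs.filter (fun b => 0 < b.length) = cs := by
  induction us generalizing cs with
  | nil => exact ⟨[], rfl, by simpa [eq_comm] using h⟩
  | cons u us ih =>
    rcases Nat.eq_zero_or_pos u with rfl | hu
    · obtain ⟨bs, h1, h2⟩ := ih cs (by simpa using h)
      exact ⟨[] :: bs, by simp [h1], by simpa using h2⟩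
    · rw [List.filter_cons_of_pos (by simpa using hu)] at h
      rcases cs with _ | ⟨c, cs⟩
      · simp at h
      simp only [List.map_cons, List.cons.injEq] at h
      obtain ⟨bs, h1, h2⟩ := ih cs h.2
      refine ⟨c :: bs, by simp [h1, h.1], ?_⟩
      rw [List.filter_cons_of_pos (by simpa [h.1] using hu), h2]

/-- A list of `s + 1` possibly empty words, the blocks between consecutive horizontal steps of a
`(d, s)`-Dyck path. -/
structure IsCabling (n m d s : ℕ) (bs : List (List (Set ℤ))) : Prop where
  length_eq : bs.length = s + 1
  isWord : ∀ b ∈ bs, IsWord n m b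
  sum_eq : (bs.map List.length).sum = d
  below : ∀ p, p <+: patternSteps (bs.map List.length) → p.count .H * d ≤ p.count .V * s

/-- The cabled Dyck path `C` is the one encoded by the words `bs`: the lengths of its vertical
blocks, empty ones included, are those of the words, and its `i`-th cable is built by the `i`-th
non-empty word. -/
structure Encodes (bs : List (List (Set ℤ))) (C : CabledDyckPath n m d s) : Prop where
  pattern_steps : C.pattern.steps = patternSteps (bs.map List.length)
  cable_steps : ∀ i, ∃ w ∈ (bs.filter fun b => 0 < b.length)[i.1]?,
    (C.cable i).steps = pathWord n m w

theorem IsCabling.ne_nil {bs : List (List (Set ℤ))} (h : IsCabling n m d s bs) : bs ≠ [] := by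
  rintro rfl
  simpa using h.length_eq

theorem verticalRuns_of_steps {P : RatDyckPath d s} {bs : List (List (Set ℤ))}
    (hbs : bs ≠ []) (h : P.steps = patternSteps (bs.map List.length)) :
    P.verticalRuns = (bs.filter fun b => 0 < b.length).map List.length := by
  rw [RatDyckPath.verticalRuns, h, splitOn_patternSteps (by simpa using hbs), List.filter_map]
  rfl

theorem IsCabling.exists_encodes (hn : 0 < n) (hmn : Nat.Coprime m n)
    {bs : List (List (Set ℤ))} (h : IsCabling n m d s bs) :
    ∃ C : CabledDyckPath n m d s, Encodes bs C := by
  have hne : bs.map List.length ≠ [] := by simpa using h.ne_nil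
  obtain ⟨hV, hH⟩ := count_patternSteps hne
  rw [h.sum_eq] at hV
  rw [List.length_map, h.length_eq] at hH
  let P : RatDyckPath d s := ⟨patternSteps (bs.map List.length), hV, by omega, h.below⟩
  have hruns : P.verticalRuns = (bs.filter fun b => 0 < b.length).map List.length :=
    verticalRuns_of_steps h.ne_nil rfl
  have hcable : ∀ i : Fin P.verticalRuns.length,
      ∃ D : RatDyckPath (P.verticalRuns.get i * n) (P.verticalRuns.get i * m),
        ∃ w ∈ (bs.filter fun b => 0 < b.length)[i.1]?, D.steps = pathWord n m w := by
    intro i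
    have hi : i.1 < (bs.filter fun b => 0 < b.length).length := by
      have := congrArg List.length hruns
      rw [List.length_map] at this
      exact this ▸ i.2
    have hget : P.verticalRuns.get i = (bs.filter fun b => 0 < b.length)[i.1].length := by
      simp [hruns]
    have hw : IsWord n m (bs.filter fun b => 0 < b.length)[i.1] :=
      h.isWord _ (List.mem_of_mem_filter (List.getElem_mem hi))
    rw [hget]
    exact ⟨hw.toDyckPath hn hmn, _, List.getElem?_eq_getElem hi, rfl⟩
  choose c hc using hcable
  exact ⟨⟨P, c⟩, rfl, hc⟩

theorem Encodes.unique_right {bs : List (List (Set ℤ))} {C C' : CabledDyckPath n m d s}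
    (h : Encodes bs C) (h' : Encodes bs C') : C = C' := by
  obtain ⟨P, c⟩ := C
  obtain ⟨P', c'⟩ := C'
  obtain rfl : P = P' := RatDyckPath.ext (h.pattern_steps.trans h'.pattern_steps.symm)
  congr 1
  funext i
  obtain ⟨w, hw, hs⟩ := h.cable_steps i
  obtain ⟨w', hw', hs'⟩ := h'.cable_steps i
  obtain rfl := Option.mem_unique hw hw'
  exact RatDyckPath.ext (hs.trans hs'.symm)

theorem Encodes.unique_left (hn : 0 < n) (hmn : Nat.Coprime m n) {bs bs' : List (List (Set ℤ))}
    {C : CabledDyckPath n m d s} (hb : IsCabling n m d s bs) (hb' : IsCabling n m d s bs')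
    (h : Encodes bs C) (h' : Encodes bs' C) : bs = bs' := by
  refine eq_of_map_length_eq_of_filter_eq ?_ ?_
  · rw [← splitOn_patternSteps (us := bs.map List.length) (by simpa using hb.ne_nil),
      ← h.pattern_steps, h'.pattern_steps, splitOn_patternSteps (by simpa using hb'.ne_nil)]
  · have hr := verticalRuns_of_steps hb.ne_nil h.pattern_steps
    have hr' := verticalRuns_of_steps hb'.ne_nil h'.pattern_steps
    have hlen := congrArg List.length hr
    have hlen' := congrArg List.length hr'
    rw [List.length_map] at hlen hlen'
    refine List.ext_getElem (hlen.symm.trans hlen') fun i h1 h2 => ?_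
    obtain ⟨w, hw, hs⟩ := h.cable_steps ⟨i, by omega⟩
    obtain ⟨w', hw', hs'⟩ := h'.cable_steps ⟨i, by omega⟩
    obtain ⟨_, rfl⟩ := List.getElem?_eq_some_iff.1 (Option.mem_def.1 hw)
    obtain ⟨_, rfl⟩ := List.getElem?_eq_some_iff.1 (Option.mem_def.1 hw')
    exact pathWord_injOn hn hmn (hb.isWord _ (List.mem_of_mem_filter (List.getElem_mem h1)))
      (hb'.isWord _ (List.mem_of_mem_filter (List.getElem_mem h2))) (hs.symm.trans hs')

theorem exists_isCabling_encodes (hn : 0 < n) (hmn : Nat.Coprime m n)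
    (C : CabledDyckPath n m d s) : ∃ bs, IsCabling n m d s bs ∧ Encodes bs C := by
  have hcable : ∀ i, ∃ w, IsWord n m w ∧ w.length = C.pattern.verticalRuns.get i ∧
      pathWord n m w = (C.cable i).steps := fun i => exists_isWord_pathWord_eq hn hmn (C.cable i)
  choose w hw hlen hsteps using hcable
  obtain ⟨bs, h1, h2⟩ := exists_map_length_eq_filter_eq
    ((C.pattern.steps.splitOn .H).map List.length) (List.ofFn w) (by
      rw [List.map_ofFn]
      refine (congrArg List.ofFn (funext hlen)).trans ?_
      exact List.ofFn_get _)
  have hpat : patternSteps (bs.map List.length) = C.pattern.steps := by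
    rw [h1, patternSteps_splitOn]
  have hne : bs.map List.length ≠ [] := by
    rw [h1]
    simp
  obtain ⟨hV, hH⟩ := count_patternSteps hne
  rw [hpat, C.pattern.count_V] at hV
  rw [hpat, C.pattern.count_H, List.length_map] at hH
  refine ⟨bs, ⟨hH.symm, fun b hb => ?_, hV.symm, ?_⟩, hpat.symm, fun i => ?_⟩
  · rcases eq_or_ne b [] with rfl | hbne
    · exact ⟨by simp, by simp, by simp, by simp⟩
    · have : b ∈ bs.filter fun b => 0 < b.length :=
        List.mem_filter.2 ⟨hb, by simpa [List.length_pos_iff] using hbne⟩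
      rw [h2, List.mem_ofFn] at this
      obtain ⟨i, rfl⟩ := this
      exact hw i
  · rw [hpat]
    exact C.pattern.below
  · exact ⟨w i, by rw [h2]; simp, (hsteps i).symm⟩

theorem exists_isCabling (hn : 0 < n) (hmn : Nat.Coprime m n) (hd : 0 < d)
    (hds : Nat.Coprime d s) (h : IsInvariantSubset n m d Δ ∧ IsSAdmissible n m d s Δ) :
    ∃ bs, IsCabling n m d s bs ∧ assemble bs = slices d s Δ := by
  rw [admissible_iff_slices hn hmn hd hds] at h
  obtain ⟨bs, hlen, hbs, he⟩ := exists_assemble_eq h.1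
  have hsum : (bs.map List.length).sum = d := by
    rw [← length_assemble, he, length_slices]
  have hne : bs ≠ [] := by rintro rfl; simp at hlen
  have hiff := below_diagonal_iff (d := d) (s := s) (i₀ := 0) (j₀ := 0) hne hbs (by omega)
    (by omega)
  refine ⟨bs, ⟨hlen, hbs, hsum, ?_⟩, he⟩
  simp only [Nat.cast_zero, zero_add, sub_zero] at hiff
  rw [hiff, he]
  exact h.2

theorem IsCabling.exists_admissible (hn : 0 < n) (hmn : Nat.Coprime m n) (hd : 0 < d)
    (hds : Nat.Coprime d s) {bs : List (List (Set ℤ))} (h : IsCabling n m d s bs) :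
    ∃ Δ, (IsInvariantSubset n m d Δ ∧ IsSAdmissible n m d s Δ) ∧ assemble bs = slices d s Δ := by
  obtain ⟨Δ, hΔ⟩ := exists_slices_eq hd hds ((length_assemble bs).trans h.sum_eq)
  refine ⟨Δ, ?_, hΔ.symm⟩
  rw [admissible_iff_slices hn hmn hd hds, hΔ]
  have hiff := below_diagonal_iff (d := d) (s := s) (i₀ := 0) (j₀ := 0) h.ne_nil h.isWord
    (by have := h.length_eq; omega) (by have := h.sum_eq; omega)
  simp only [Nat.cast_zero, zero_add, sub_zero] at hiff
  refine ⟨?_, hiff.1 h.below⟩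
  have := isDescending_assemble h.isWord
  rwa [h.length_eq] at this

end CabledDyck

open CabledDyck in
theorem theorem1p7 (n m d s : ℕ) (hn : 0 < n) (hm : 0 < m) (hd : 0 < d) (hs : 0 < s)
    (hmn : Nat.gcd m n = 1) (hds : Nat.gcd d s = 1) :
    ∃ f : {Δ : Set ℤ // IsInvariantSubset n m d Δ ∧ IsSAdmissible n m d s Δ} →
        CabledDyckPath n m d s,
      Function.Bijective f := by
  have hex : ∀ Δ : {Δ : Set ℤ // IsInvariantSubset n m d Δ ∧ IsSAdmissible n m d s Δ},
      ∃ C : CabledDyckPath n m d s, ∃ bs, IsCabling n m d s bs ∧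
        assemble bs = slices d s Δ.1 ∧ Encodes bs C := by
    intro Δ
    obtain ⟨bs, hbs, he⟩ := exists_isCabling hn hmn hd hds Δ.2
    obtain ⟨C, hC⟩ := hbs.exists_encodes hn hmn
    exact ⟨C, bs, hbs, he, hC⟩
  choose f bs hbs he hf using hex
  refine ⟨f, fun Δ Δ' h => ?_, fun C => ?_⟩
  · have h1 : bs Δ = bs Δ' :=
      Encodes.unique_left hn hmn (hbs Δ) (hbs Δ') (hf Δ) (h ▸ hf Δ')
    refine Subtype.ext (slices_injective hd hds ?_)
    rw [← he, ← he, h1]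
  · obtain ⟨cs, hcs, hC⟩ := exists_isCabling_encodes hn hmn C
    obtain ⟨Δ, hΔ, hcsΔ⟩ := hcs.exists_admissible hn hmn hd hds
    refine ⟨⟨Δ, hΔ⟩, ?_⟩
    have h1 : bs ⟨Δ, hΔ⟩ = cs := assemble_injective
      ((hbs _).length_eq.trans hcs.length_eq.symm) (hbs _).isWord hcs.isWord
      ((he _).trans hcsΔ.symm)
    exact (hf ⟨Δ, hΔ⟩).unique_right (h1.symm ▸ hC)
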